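/- Let $T$ be a finite set of targets with $|T|\ge 3$, let $D$ be a finite nonempty set of depots, disjoint from $T$, and let $C_1,\dots,C_m$ be a partition of $T$ into nonempty clusters. Let $V=T\cup D$ and let $E$ be the set of all edges $\{u,v\}$, $u\ne v$, of $V$ with at least one end in $T$. For $A\subseteq V$ let $\gamma(A)$ be the set of edges with both ends in $A$ and $\delta(A)$ the set of edges with exactly one end in $A$, for disjoint $A,B\subseteq V$ let $(A:B)$ be the set of edges with one end in $A$ and the other in $B$, and for $F\subseteq E$ let $x(F)=\sum_{e\in F}x_e$. Let $P\subseteq\mathbb R^{E}\times\mathbb R^{T}$ be the generalized multiple depot travelling salesmen polytope, i.e. the convex hull of all $(x,y)$ that satisfy \begin{itemize} \item $x(\delta(\{i\}))=2y_i$ for all $i\in T$; \item $\sum_{i\in C_h}y_i\ge 1$ for all $h=1,\dots,m$; \item $x(\delta(S'))\ge 2y_i$ for all $S'\subseteq T$ and $i\in S'$; \item $x(D':\{j\})+3x_{jk}+x(\{k\}:D\setminus D')\le 2(y_j+y_k)$ for all distinct $j,k\in T$ and all $D'\subsetneq D$; \item $x(D':\{j\})+2x(\gamma(S'\cup\{j,k\}))+x(\{k\}:D\setminus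 D')\le \sum_{v\in S'}2y_v+2(y_j+y_k)-y_i$ for all distinct $j,k\in T$, all nonempty $S'\subseteq T\setminus\{j,k\}$, all $i\in S'$ and all $D'\subsetneq D$; \item $x_e\in\{0,1\}$ for $e\in\gamma(T)$, $x_e\in\{0,1,2\}$ for $e\in(D:T)$, and $y_i\in\{0,1\}$ for $i\in T$. \end{itemize} Let $S\subseteq T$ and $i\in S$, let $\mu(S)=|\{h: C_h\subseteq S\}|$, and let $\bar\beta_i=2$ if $\mu(S)=0$ and $\bar\beta_i=0$ otherwise. Then the generalized sub-tour elimination constraint $$x(\delta(S))+\bar\beta_i(1-y_i)\ge 2$$ is valid for $P$ (every point of $P$ satisfies it), and if $|S|\ge 2$, it is facet-defining for $P$: the points of $P$ that satisfy it with equality form a nonempty face of $P$ of dimension $\dim P-1$. -/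

import Mathlib

/-- The graph of the problem: the vertices are the targets `T` and the depots `D`, and two distinct
vertices are joined by an edge iff at least one of them is a target. -/
def gmdtspGraph (T D : Type*) : SimpleGraph (T ⊕ D) where
  Adj u v := u ≠ v ∧ (u.isLeft = true ∨ v.isLeft = true)
  symm := ⟨fun _ _ h => ⟨h.1.symm, h.2.symm⟩⟩
  loopless := ⟨fun _ h => h.1 rfl⟩

/-- The edge set `E`. -/
abbrev GEdge (T D : Type*) : Type _ := {e : Sym2 (T ⊕ D) // e ∈ (gmdtspGraph T D).edgeSet}

noncomputable instance GEdge.instFintype (T D : Type*) [Fintype T] [Fintype D] :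
    Fintype (GEdge T D) := Fintype.ofFinite _

/-- The space of pairs `(x, y)`, with `x` indexed by the edges and `y` indexed by the targets. -/
abbrev GSpace (T D : Type*) : Type _ := (GEdge T D → ℝ) × (T → ℝ)

/-- The edge joining the distinct targets `j` and `k`. -/
def targetEdge {T : Type*} (D : Type*) (j k : T) (h : j ≠ k) : GEdge T D :=
  ⟨s(Sum.inl j, Sum.inl k), fun hjk => h (Sum.inl_injective hjk), Or.inl rfl⟩

/-- `γ(S)`: the edges with both ends in `S`. -/
def gammaEdges {T D : Type*} (S : Set (T ⊕ D)) : Set (GEdge T D) :=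
  {e | ∃ u ∈ S, ∃ v ∈ S, e.1 = s(u, v)}

/-- `δ(S)`: the edges with exactly one end in `S`. -/
def deltaEdges {T D : Type*} (S : Set (T ⊕ D)) : Set (GEdge T D) :=
  {e | ∃ u ∈ S, ∃ v ∉ S, e.1 = s(u, v)}

/-- `(A : B)`: the edges with one end in `A` and the other end in `B`. -/
def betweenEdges {T D : Type*} (A B : Set (T ⊕ D)) : Set (GEdge T D) :=
  {e | ∃ u ∈ A, ∃ v ∈ B, e.1 = s(u, v)}

/-- `x(F)`, the sum of `x e` over the edges `e` in `F`. -/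
noncomputable def edgeSum {T D : Type*} [Fintype T] [Fintype D] (x : GEdge T D → ℝ)
    (F : Set (GEdge T D)) : ℝ :=
  ∑ e, F.indicator x e

/-- A set of targets, as a set of vertices. -/
def targetSet {T : Type*} (D : Type*) (S : Set T) : Set (T ⊕ D) := Sum.inl '' S

/-- A set of depots, as a set of vertices. -/
def depotSet (T : Type*) {D : Type*} (D' : Set D) : Set (T ⊕ D) := Sum.inr '' D'

/-- The feasible solutions `(x, y)` of the generalized multiple depot travelling salesmen problem
with clusters `C`: the solutions of its integer programming formulation. -/
structure IsFeasibleGMDTSP {T D : Type*} [Fintype T] [Fintype D] {m : ℕ} (C : Fin m → Finset T)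
    (z : GSpace T D) : Prop where
  /-- degree constraints -/
  degree : ∀ i : T, edgeSum z.1 (deltaEdges (targetSet D {i})) = 2 * z.2 i
  /-- every cluster is visited -/
  assignment : ∀ h : Fin m, 1 ≤ ∑ i ∈ C h, z.2 i
  /-- sub-tour elimination constraints -/
  subtour : ∀ S : Finset T, ∀ i ∈ S, 2 * z.2 i ≤ edgeSum z.1 (deltaEdges (targetSet D (S : Set T)))
  /-- path elimination constraints for paths that visit two targets -/
  path_two : ∀ (j k : T) (hjk : j ≠ k) (D' : Set D), D' ⊂ Set.univ →
    edgeSum z.1 (betweenEdges (depotSet T D') (targetSet D {j})) +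
      3 * z.1 (targetEdge D j k hjk) +
      edgeSum z.1 (betweenEdges (targetSet D {k}) (depotSet T D'ᶜ)) ≤ 2 * (z.2 j + z.2 k)
  /-- path elimination constraints for paths that visit at least three targets -/
  path : ∀ (j k : T), j ≠ k → ∀ S : Finset T, j ∉ S → k ∉ S → ∀ i ∈ S,
    ∀ D' : Set D, D' ⊂ Set.univ →
    edgeSum z.1 (betweenEdges (depotSet T D') (targetSet D {j})) +
      2 * edgeSum z.1 (gammaEdges (targetSet D ((S : Set T) ∪ {j, k}))) +
      edgeSum z.1 (betweenEdges (targetSet D {k}) (depotSet T D'ᶜ)) ≤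
    ∑ v ∈ S, 2 * z.2 v + 2 * (z.2 j + z.2 k) - z.2 i
  /-- edges between targets are used at most once -/
  integer_target : ∀ e ∈ gammaEdges (targetSet D (Set.univ : Set T)), z.1 e = 0 ∨ z.1 e = 1
  /-- edges between a depot and a target are used at most twice -/
  integer_depot : ∀ e ∈ betweenEdges (depotSet T (Set.univ : Set D)) (targetSet D Set.univ),
    z.1 e = 0 ∨ z.1 e = 1 ∨ z.1 e = 2
  integer_y : ∀ i : T, z.2 i = 0 ∨ z.2 i = 1

/-- The polytope `P`: the convex hull of the feasible solutions. -/
def gmdtspPolytope {T : Type*} (D : Type*) [Fintype T] [Fintype D] {m : ℕ}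
    (C : Fin m → Finset T) : Set (GSpace T D) :=
  convexHull ℝ {z | IsFeasibleGMDTSP C z}

/-- `μ(S)`: the number of clusters that are contained in `S`. -/
noncomputable def clusterCount {T : Type*} {m : ℕ} (C : Fin m → Finset T) (S : Finset T) : ℕ :=
  {h : Fin m | C h ⊆ S}.ncard

/-- The coefficient of `1 - y_i`: it is `2` if `S` contains no cluster, and `0` otherwise. -/
noncomputable def betaBar {T : Type*} {m : ℕ} (C : Fin m → Finset T) (S : Finset T) : ℝ :=
  if clusterCount C S = 0 then 2 else 0

/-- The left hand side `x(δ(S)) + β (1 - y_i)` of the generalized sub-tour elimination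
constraint. -/
noncomputable def gsecLHS {T D : Type*} [Fintype T] [Fintype D] {m : ℕ} (C : Fin m → Finset T)
    (S : Finset T) (i : T) (z : GSpace T D) : ℝ :=
  edgeSum z.1 (deltaEdges (targetSet D (S : Set T))) + betaBar C S * (1 - z.2 i)

/-- `F` is a facet of `P`: a nonempty (exposed) face of dimension `dim P - 1`. -/
def IsFacet {V : Type*} [NormedAddCommGroup V] [NormedSpace ℝ V] (P F : Set V) : Prop :=
  IsExposed ℝ P F ∧ F.Nonempty ∧
    Module.finrank ℝ (vectorSpan ℝ F) + 1 = Module.finrank ℝ (vectorSpan ℝ P)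

/-- The inequality `b ≤ f z` is valid for `P`. -/
def IsValidFor {V : Type*} (P : Set V) (f : V → ℝ) (b : ℝ) : Prop :=
  ∀ z ∈ P, b ≤ f z

/-- The inequality `b ≤ f z` is facet-defining for `P`: it is valid, and the points of `P` where it
is tight form a facet. -/
def IsFacetDefiningFor {V : Type*} [NormedAddCommGroup V] [NormedSpace ℝ V] (P : Set V)
    (f : V → ℝ) (b : ℝ) : Prop :=
  IsValidFor P f b ∧ IsFacet P {z | z ∈ P ∧ f z = b}

/-! Validity needs checking only at feasible points. If some cluster lies in `S`, one of its targets
is visited, and the sub-tour constraint of that target gives `2 ≤ x(δ(S))`; otherwise the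
coefficient is `2` and the inequality is the sub-tour constraint of `i` rearranged. A half-space is
convex, so the bound passes to the hull (`gsec_valid`).

The dimension of `P` depends on which clusters are singletons, so it is never computed. Instead
`isFacet_convexHull` reduces the facet property to a statement about functionals: any linear `ℓ`
that is constant on the tight feasible points agrees on all feasible points with `t * f + c'`, where
`f` is the left hand side.

The test points are flowers `petalsVec`: one closed walk through a depot, plus single-target petals.
They satisfy every constraint by `isTourPart_petalsVec` and `IsTourPart.isFeasible`. A flower
visiting all targets, with those of `S` consecutive in the main petal, is tight. Exchanges between
such flowers determine the edge part of `ℓ` up to degrees and a multiple of `x(δ(S))`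
(`exists_eq_degree_add_cut`). Since degrees equal `2 * y v` at feasible points, `ℓ` becomes `∑ e v *
y v + t * x(δ(S))` there. Flowers omitting one target, or all of `S`, then determine the remaining
coefficients (`exists_eq_mul_gsecLHS_add`). -/

/-! ### Edge sums, cuts and the handshake identity -/

section EdgeSum

variable {T D : Type*}

/-- The edge joining the depot `d` and the target `v`. -/
def depotEdge (d : D) (v : T) : GEdge T D :=
  ⟨s(Sum.inr d, Sum.inl v), fun h => Sum.inr_ne_inl h, Or.inr rfl⟩

theorem GEdge.cases {p : GEdge T D → Prop}
    (hT : ∀ (u v : T) (h : u ≠ v), p (targetEdge D u v h))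
    (hD : ∀ (d : D) (v : T), p (depotEdge d v)) (e : GEdge T D) : p e := by
  obtain ⟨e, he⟩ := e
  induction e using Sym2.ind with
  | _ a b =>
    rcases a with u | d <;> rcases b with v | d'
    · exact hT u v fun h => he.1 (congrArg _ h)
    · have := hD d' u
      simp only [depotEdge, Sym2.eq_swap (a := Sum.inr d')] at this
      exact this
    · exact hD d v
    · rcases he.2 with h | h <;> simp at h

theorem targetEdge_mem_gammaEdges {A : Set T} {u v : T} (h : u ≠ v) :
    targetEdge D u v h ∈ gammaEdges (targetSet D A) ↔ u ∈ A ∧ v ∈ A := by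
  simp [gammaEdges, targetEdge, targetSet]
  aesop

theorem depotEdge_mem_gammaEdges {A : Set T} {d : D} {v : T} :
    depotEdge d v ∉ gammaEdges (targetSet D A) := by
  simp [gammaEdges, depotEdge, targetSet]

theorem targetEdge_mem_deltaEdges {A : Set T} {u v : T} (h : u ≠ v) :
    targetEdge D u v h ∈ deltaEdges (targetSet D A) ↔ ¬(u ∈ A ↔ v ∈ A) := by
  simp only [deltaEdges, targetEdge, targetSet, Set.mem_ofPred_eq]
  constructor
  · rintro ⟨_, ⟨a, ha, rfl⟩, b, hb, he⟩
    rcases Sym2.eq_iff.1 he with ⟨h1, rfl⟩ | ⟨rfl, h1⟩ <;>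
      simp_all [Sum.inl_injective.eq_iff]
  · intro h'
    by_cases hu : u ∈ A
    · exact ⟨_, ⟨u, hu, rfl⟩, Sum.inl v, by simpa [hu] using h', rfl⟩
    · exact ⟨_, ⟨v, by simpa [hu] using h', rfl⟩, Sum.inl u, by simpa using hu, Sym2.eq_swap⟩

theorem depotEdge_mem_deltaEdges {A : Set T} {d : D} {v : T} :
    depotEdge d v ∈ deltaEdges (targetSet D A) ↔ v ∈ A := by
  simp [deltaEdges, depotEdge, targetSet]

theorem targetEdge_mem_betweenEdges {A : Set T} {B : Set D} {u v : T} (h : u ≠ v) :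
    targetEdge D u v h ∉ betweenEdges (depotSet T B) (targetSet D A) := by
  simp [betweenEdges, targetEdge, targetSet, depotSet]

theorem depotEdge_mem_betweenEdges {A : Set T} {B : Set D} {d : D} {v : T} :
    depotEdge d v ∈ betweenEdges (depotSet T B) (targetSet D A) ↔ d ∈ B ∧ v ∈ A := by
  simp [betweenEdges, depotEdge, targetSet, depotSet]

theorem betweenEdges_comm (A B : Set (T ⊕ D)) : betweenEdges A B = betweenEdges B A := by
  ext e
  constructor <;> rintro ⟨u, hu, v, hv, h⟩ <;> exact ⟨v, hv, u, hu, h.trans Sym2.eq_swap⟩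

variable [Fintype T]

/-- Only the two ends of an edge see it in their degrees. This gives the coefficient of the edge in
a weighted sum of degrees, which turns identities between edge sums into checks edge by edge. -/
theorem sum_indicator_degree_targetEdge (σ : T → ℝ) {u v : T} (h : u ≠ v) :
    ∑ w, σ w * (deltaEdges (targetSet D {w})).indicator 1 (targetEdge D u v h) = σ u + σ v := by
  classical
  have : ∀ w, σ w * (deltaEdges (targetSet D {w})).indicator 1 (targetEdge D u v h) =
      (if w = u then σ w else 0) + (if w = v then σ w else 0) := by
    intro w
    rw [Set.indicator_apply, targetEdge_mem_deltaEdges]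
    simp only [Set.mem_singleton_iff, eq_comm (a := w)]
    by_cases h1 : u = w <;> by_cases h2 : v = w <;> simp [h1, h2]
    exact absurd (h1.trans h2.symm) h
  simp [this, Finset.sum_add_distrib]

theorem sum_indicator_degree_depotEdge (σ : T → ℝ) (d : D) (v : T) :
    ∑ w, σ w * (deltaEdges (targetSet D {w})).indicator 1 (depotEdge d v) = σ v := by
  classical
  have : ∀ w, σ w * (deltaEdges (targetSet D {w})).indicator 1 (depotEdge d v) =
      (if w = v then σ w else 0) := by
    intro w
    rw [Set.indicator_apply, depotEdge_mem_deltaEdges]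
    by_cases h2 : w = v <;> simp_all [eq_comm]
  simp [this]

variable [Fintype D]

theorem edgeSum_add (x x' : GEdge T D → ℝ) (F : Set (GEdge T D)) :
    edgeSum (x + x') F = edgeSum x F + edgeSum x' F := by
  simp only [edgeSum, Set.indicator_add', Pi.add_apply, Finset.sum_add_distrib]

theorem edgeSum_smul (c : ℝ) (x : GEdge T D → ℝ) (F : Set (GEdge T D)) :
    edgeSum (c • x) F = c * edgeSum x F := by
  simp only [edgeSum, Finset.mul_sum]
  refine Finset.sum_congr rfl fun e _ => ?_
  by_cases h : e ∈ F <;> simp [h]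

theorem edgeSum_zero (F : Set (GEdge T D)) : edgeSum (0 : GEdge T D → ℝ) F = 0 := by
  simp [edgeSum]

theorem edgeSum_nonneg {x : GEdge T D → ℝ} (hx : 0 ≤ x) (F : Set (GEdge T D)) :
    0 ≤ edgeSum x F :=
  Finset.sum_nonneg fun e _ => Set.indicator_nonneg (fun e _ => hx e) e

theorem edgeSum_mono {x : GEdge T D → ℝ} (hx : 0 ≤ x) {F G : Set (GEdge T D)} (h : F ⊆ G) :
    edgeSum x F ≤ edgeSum x G :=
  Finset.sum_le_sum fun e _ => Set.indicator_le_indicator_of_subset h hx e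

theorem le_edgeSum {x : GEdge T D → ℝ} (hx : 0 ≤ x) {F : Set (GEdge T D)} {e : GEdge T D}
    (he : e ∈ F) : x e ≤ edgeSum x F := by
  have := Finset.single_le_sum (f := F.indicator x)
    (fun e _ => Set.indicator_nonneg (fun e _ => hx e) e) (Finset.mem_univ e)
  rwa [Set.indicator_of_mem he] at this

theorem edgeSum_add_le {x : GEdge T D → ℝ} (hx : 0 ≤ x) {F G H : Set (GEdge T D)}
    (hFG : Disjoint F G) (hF : F ⊆ H) (hG : G ⊆ H) :
    edgeSum x F + edgeSum x G ≤ edgeSum x H := by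
  have : edgeSum x F + edgeSum x G = edgeSum x (F ∪ G) := by
    simp [edgeSum, Set.indicator_union_of_disjoint hFG, Finset.sum_add_distrib]
  rw [this]
  exact edgeSum_mono hx (Set.union_subset hF hG)

/-- Two disjoint sets of depot edges at targets of `A` are contained in the cut `δ(A)`. -/
theorem edgeSum_between_add_le {x : GEdge T D → ℝ} (hx : 0 ≤ x) {A : Set T} {j k : T}
    (hj : j ∈ A) (hk : k ∈ A) (D' : Set D) :
    edgeSum x (betweenEdges (depotSet T D') (targetSet D {j})) +
      edgeSum x (betweenEdges (targetSet D {k}) (depotSet T D'ᶜ)) ≤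
    edgeSum x (deltaEdges (targetSet D A)) := by
  rw [betweenEdges_comm (targetSet D {k})]
  apply edgeSum_add_le hx
  · rw [Set.disjoint_left]
    apply GEdge.cases
    · intro u v h h'
      exact absurd h' (targetEdge_mem_betweenEdges h)
    · intro d v
      simp only [depotEdge_mem_betweenEdges]
      tauto
  · apply GEdge.cases
    · intro u v h h'
      exact absurd h' (targetEdge_mem_betweenEdges h)
    · intro d v
      simp only [depotEdge_mem_betweenEdges, depotEdge_mem_deltaEdges]
      rintro ⟨-, rfl⟩
      exact hj
  · apply GEdge.cases
    · intro u v h h'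
      exact absurd h' (targetEdge_mem_betweenEdges h)
    · intro d v
      simp only [depotEdge_mem_betweenEdges, depotEdge_mem_deltaEdges]
      rintro ⟨-, rfl⟩
      exact hk

/-- A weighted sum of the degrees, as a sum over the edges. -/
theorem sum_mul_degree (σ : T → ℝ) (x : GEdge T D → ℝ) :
    ∑ v, σ v * edgeSum x (deltaEdges (targetSet D {v})) =
      ∑ e, (∑ v, σ v * (deltaEdges (targetSet D {v})).indicator 1 e) * x e := by
  simp only [edgeSum, Finset.mul_sum, Finset.sum_mul]
  rw [Finset.sum_comm]
  refine Finset.sum_congr rfl fun e _ => Finset.sum_congr rfl fun v _ => ?_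
  by_cases h : e ∈ deltaEdges (targetSet D {v}) <;> simp [h]

/-- The handshake identity. -/
theorem sum_degree (x : GEdge T D → ℝ) (A : Finset T) :
    ∑ v ∈ A, edgeSum x (deltaEdges (targetSet D {v})) =
      edgeSum x (deltaEdges (targetSet D (A : Set T))) +
        2 * edgeSum x (gammaEdges (targetSet D (A : Set T))) := by
  classical
  have h1 := sum_mul_degree (fun v => if v ∈ A then 1 else 0) x
  simp only [ite_mul, one_mul, zero_mul, Finset.sum_ite_mem, Finset.univ_inter] at h1
  rw [h1, edgeSum, edgeSum, Finset.mul_sum, ← Finset.sum_add_distrib]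
  refine Finset.sum_congr rfl fun e _ => ?_
  have h2 : ∑ v ∈ A, (deltaEdges (targetSet D {v})).indicator (1 : GEdge T D → ℝ) e =
      ∑ v, (if v ∈ A then 1 else 0) * (deltaEdges (targetSet D {v})).indicator 1 e := by
    simp
  rw [h2]
  induction e using GEdge.cases with
  | hT u v h =>
    rw [sum_indicator_degree_targetEdge, Set.indicator_apply, Set.indicator_apply,
      targetEdge_mem_deltaEdges, targetEdge_mem_gammaEdges]
    by_cases h1 : u ∈ A <;> by_cases h2 : v ∈ A <;> simp [h1, h2, ← two_mul]
  | hD d v =>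
    rw [sum_indicator_degree_depotEdge, Set.indicator_apply,
      Set.indicator_of_notMem depotEdge_mem_gammaEdges, depotEdge_mem_deltaEdges]
    by_cases h2 : v ∈ A <;> simp [h2]

end EdgeSum

/-! ### Closed walks through a depot and their cuts -/

section Walk

variable {T D : Type*}

/-- The incidence vector of the edge `s`; it is zero if `s` is not an edge of the graph. -/
noncomputable def edgeVec (s : Sym2 (T ⊕ D)) : GEdge T D → ℝ :=
  Set.indicator {e | e.1 = s} 1

/-- The vector that counts how often a walk uses each edge. -/
noncomputable def walkVec : List (T ⊕ D) → GEdge T D → ℝ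
  | a :: b :: l => edgeVec s(a, b) + walkVec (b :: l)
  | _ => 0

theorem walkVec_singleton (a : T ⊕ D) : walkVec [a] = 0 := rfl

theorem walkVec_cons_cons (a b : T ⊕ D) (l : List (T ⊕ D)) :
    walkVec (a :: b :: l) = edgeVec s(a, b) + walkVec (b :: l) := rfl

theorem walkVec_append (l₁ : List (T ⊕ D)) (a : T ⊕ D) (l₂ : List (T ⊕ D)) :
    walkVec (l₁ ++ a :: l₂) = walkVec (l₁ ++ [a]) + walkVec (a :: l₂) := by
  induction l₁ with
  | nil => simp [walkVec_singleton]
  | cons b l ih =>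
    cases l with
    | nil => simp [walkVec_cons_cons, walkVec_singleton]
    | cons c l =>
      simp only [List.cons_append, walkVec_cons_cons] at ih ⊢
      rw [ih, add_assoc]

/-- The closed walk that starts at the depot `d` and visits the targets of `L` in this order. -/
noncomputable def petal (d : D) (L : List T) : GEdge T D → ℝ :=
  walkVec (Sum.inr d :: (L.map Sum.inl ++ [Sum.inr d]))

theorem edgeVec_apply_eq (s : Sym2 (T ⊕ D)) (e : GEdge T D) (h : e.1 = s) : edgeVec s e = 1 := by
  simp [edgeVec, h]

theorem edgeVec_apply_ne (s : Sym2 (T ⊕ D)) (e : GEdge T D) (h : e.1 ≠ s) : edgeVec s e = 0 := by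
  simp [edgeVec, h]

theorem exists_nat_walkVec (l : List (T ⊕ D)) (e : GEdge T D) : ∃ n : ℕ, walkVec l e = n := by
  induction l with
  | nil => exact ⟨0, by simp [walkVec]⟩
  | cons a l ih =>
    cases l with
    | nil => exact ⟨0, by simp [walkVec]⟩
    | cons b l =>
      obtain ⟨n, hn⟩ := ih
      rw [walkVec_cons_cons, Pi.add_apply, hn]
      by_cases h : e.1 = s(a, b)
      · exact ⟨1 + n, by rw [edgeVec_apply_eq _ _ h]; push_cast; rfl⟩
      · exact ⟨n, by rw [edgeVec_apply_ne _ _ h, zero_add]⟩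

theorem walkVec_nonneg (l : List (T ⊕ D)) : (0 : GEdge T D → ℝ) ≤ walkVec l := fun e => by
  obtain ⟨n, hn⟩ := exists_nat_walkVec l e
  simp [hn]

variable [Fintype T] [Fintype D]

theorem edgeSum_edgeVec_of_mem (F : Set (GEdge T D)) (e : GEdge T D) (h : e ∈ F) :
    edgeSum (edgeVec e.1) F = 1 := by
  rw [edgeSum, Finset.sum_eq_single e]
  · rw [Set.indicator_of_mem h, edgeVec_apply_eq _ _ rfl]
  · intro e' _ he
    have := edgeVec_apply_ne e.1 e' fun h => he (Subtype.ext h)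
    by_cases h' : e' ∈ F <;> simp [h', this]
  · simp

theorem edgeSum_edgeVec_of_forall {F : Set (GEdge T D)} {s : Sym2 (T ⊕ D)}
    (h : ∀ e ∈ F, e.1 ≠ s) : edgeSum (edgeVec s) F = 0 := by
  refine Finset.sum_eq_zero fun e _ => ?_
  by_cases he : e ∈ F
  · rw [Set.indicator_of_mem he, edgeVec_apply_ne _ _ (h e he)]
  · rw [Set.indicator_of_notMem he]

theorem edgeSum_edgeVec_delta_of_iff {A : Set (T ⊕ D)} {a b : T ⊕ D} (h : a ∈ A ↔ b ∈ A) :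
    edgeSum (edgeVec s(a, b)) (deltaEdges A) = 0 := by
  apply edgeSum_edgeVec_of_forall
  rintro e ⟨u, hu, v, hv, he⟩ h'
  rcases Sym2.eq_iff.1 (he.symm.trans h') with ⟨rfl, rfl⟩ | ⟨rfl, rfl⟩ <;> tauto

theorem edgeSum_edgeVec_delta_of_mem {A : Set T} {u : T} {b : T ⊕ D} (hu : u ∈ A)
    (hb : b ∉ targetSet D A) :
    edgeSum (edgeVec s(Sum.inl u, b)) (deltaEdges (targetSet D A)) = 1 :=
  edgeSum_edgeVec_of_mem _
    ⟨s(Sum.inl u, b), fun h => hb ⟨u, hu, h⟩, Or.inl rfl⟩ ⟨_, ⟨u, hu, rfl⟩, _, hb, rfl⟩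

theorem edgeSum_edgeVec_delta_of_mem' {A : Set T} {u : T} {b : T ⊕ D} (hu : u ∈ A)
    (hb : b ∉ targetSet D A) :
    edgeSum (edgeVec s(b, Sum.inl u)) (deltaEdges (targetSet D A)) = 1 := by
  rw [Sym2.eq_swap, edgeSum_edgeVec_delta_of_mem hu hb]

omit [Fintype T] [Fintype D] in
theorem inl_mem_targetSet {A : Set T} {v : T} : Sum.inl v ∈ targetSet D A ↔ v ∈ A := by
  simp [targetSet]

omit [Fintype T] [Fintype D] in
theorem inr_notMem_targetSet {A : Set T} {d : D} : Sum.inr d ∉ targetSet D A := by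
  simp [targetSet]

theorem edgeSum_walkVec_eq_zero {F : Set (GEdge T D)} {l : List (T ⊕ D)}
    (h : ∀ a ∈ l, ∀ b ∈ l, edgeSum (edgeVec s(a, b)) F = 0) : edgeSum (walkVec l) F = 0 := by
  induction l with
  | nil => simp [walkVec, edgeSum_zero]
  | cons a l ih =>
    cases l with
    | nil => simp [walkVec, edgeSum_zero]
    | cons b l =>
      rw [walkVec_cons_cons, edgeSum_add, h a (by simp) b (by simp), zero_add]
      exact ih fun a ha b hb => h a (List.mem_cons_of_mem _ ha) b (List.mem_cons_of_mem _ hb)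

/-- A walk that does not meet `A` does not cross its boundary. -/
theorem edgeSum_walkVec_delta_of_forall_notMem {A : Set (T ⊕ D)} {l : List (T ⊕ D)}
    (h : ∀ a ∈ l, a ∉ A) : edgeSum (walkVec l) (deltaEdges A) = 0 :=
  edgeSum_walkVec_eq_zero fun a ha b hb =>
    edgeSum_edgeVec_delta_of_iff (by simp [h a ha, h b hb])

/-- A walk that starts with targets of `A` and then stays outside of `A` leaves `A` once. -/
theorem edgeSum_walkVec_delta_leave {A : Set T} {u : T} {L : List T} {l : List (T ⊕ D)}
    (hu : u ∈ A) (hL : ∀ v ∈ L, v ∈ A) (hl : ∀ a ∈ l, a ∉ targetSet D A) (hne : l ≠ []) :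
    edgeSum (walkVec (Sum.inl u :: (L.map Sum.inl ++ l))) (deltaEdges (targetSet D A)) = 1 := by
  induction L generalizing u with
  | nil =>
    obtain ⟨b, l, rfl⟩ := List.exists_cons_of_ne_nil hne
    rw [List.map_nil, List.nil_append, walkVec_cons_cons, edgeSum_add,
      edgeSum_walkVec_delta_of_forall_notMem hl,
      edgeSum_edgeVec_delta_of_mem hu (hl b (by simp)), add_zero]
  | cons v L ih =>
    have hv := hL v (by simp)
    rw [List.map_cons, List.cons_append, walkVec_cons_cons, edgeSum_add,
      ih hv fun w hw => hL w (by simp [hw]), edgeSum_edgeVec_delta_of_iff, zero_add]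
    simp [inl_mem_targetSet, hu, hv]

/-- A petal that starts with the targets of `L` in `A`, and then visits targets outside of `A`,
crosses the boundary of `A` twice. -/
theorem edgeSum_petal_delta {A : Set T} (d : D) {L L' : List T}
    (hL : ∀ v ∈ L, v ∈ A) (hne : L ≠ []) (hL' : ∀ v ∈ L', v ∉ A) :
    edgeSum (petal d (L ++ L')) (deltaEdges (targetSet D A)) = 2 := by
  obtain ⟨u, L, rfl⟩ := List.exists_cons_of_ne_nil hne
  have hu := hL u (by simp)
  rw [petal, List.map_append, List.append_assoc, List.map_cons, List.cons_append,
    walkVec_cons_cons, edgeSum_add,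
    edgeSum_walkVec_delta_leave hu (fun w hw => hL w (by simp [hw])) _ (by simp),
    edgeSum_edgeVec_delta_of_mem' hu inr_notMem_targetSet, one_add_one_eq_two]
  intro a ha
  simp only [List.mem_append, List.mem_map, List.mem_singleton] at ha
  rcases ha with ⟨v, hv, rfl⟩ | rfl
  · rw [inl_mem_targetSet]
    exact hL' v hv
  · exact inr_notMem_targetSet

theorem edgeSum_petal_delta_eq_zero {A : Set T} (d : D) {L : List T} (hL : ∀ v ∈ L, v ∉ A) :
    edgeSum (petal d L) (deltaEdges (targetSet D A)) = 0 := by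
  apply edgeSum_walkVec_delta_of_forall_notMem
  intro a ha
  simp only [List.mem_cons, List.mem_append, List.mem_map, List.not_mem_nil, or_false] at ha
  rcases ha with rfl | ⟨v, hv, rfl⟩ | rfl
  · exact inr_notMem_targetSet
  · rw [inl_mem_targetSet]
    exact hL v hv
  · exact inr_notMem_targetSet

/-- A walk from a target of `A` to a depot leaves `A`. -/
theorem one_le_edgeSum_walkVec {A : Set T} {u : T} (L : List T) (d : D) (hu : u ∈ A) :
    1 ≤ edgeSum (walkVec (Sum.inl u :: (L.map Sum.inl ++ [Sum.inr d])))
      (deltaEdges (targetSet D A)) := by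
  induction L generalizing u with
  | nil =>
    rw [List.map_nil, List.nil_append, walkVec_cons_cons, edgeSum_add,
      edgeSum_edgeVec_delta_of_mem hu inr_notMem_targetSet, walkVec_singleton, edgeSum_zero,
      add_zero]
  | cons v L ih =>
    rw [List.map_cons, List.cons_append, walkVec_cons_cons, edgeSum_add]
    by_cases hv : v ∈ A
    · rw [edgeSum_edgeVec_delta_of_iff (by simp [inl_mem_targetSet, hu, hv]), zero_add]
      exact ih hv
    · rw [edgeSum_edgeVec_delta_of_mem hu (by rwa [inl_mem_targetSet])]
      exact le_add_of_nonneg_right (edgeSum_nonneg (walkVec_nonneg _) _)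

/-- A walk from outside of `A` to a depot that meets `A` crosses the boundary of `A` twice. -/
theorem two_le_edgeSum_walkVec {A : Set T} {a : T ⊕ D} (L : List T) (d : D)
    (ha : a ∉ targetSet D A) {v : T} (hvL : v ∈ L) (hvA : v ∈ A) :
    2 ≤ edgeSum (walkVec (a :: (L.map Sum.inl ++ [Sum.inr d])))
      (deltaEdges (targetSet D A)) := by
  induction L generalizing a with
  | nil => simp at hvL
  | cons w L ih =>
    rw [List.map_cons, List.cons_append, walkVec_cons_cons, edgeSum_add]
    by_cases hw : w ∈ A
    · rw [edgeSum_edgeVec_delta_of_mem' hw ha]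
      linarith [one_le_edgeSum_walkVec L d hw]
    · rw [edgeSum_edgeVec_delta_of_iff (by simp [inl_mem_targetSet, hw, ha]), zero_add]
      refine ih (by rwa [inl_mem_targetSet]) ?_
      rcases List.mem_cons.1 hvL with rfl | h
      · exact absurd hvA hw
      · exact h

theorem two_le_edgeSum_petal {A : Set T} {L : List T} (d : D) {v : T} (hvL : v ∈ L)
    (hvA : v ∈ A) : 2 ≤ edgeSum (petal d L) (deltaEdges (targetSet D A)) :=
  two_le_edgeSum_walkVec L d inr_notMem_targetSet hvL hvA

/-- The walk splits at the only occurrence of `v`; each half uses exactly one edge at `v`. -/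
theorem edgeSum_petal_degree (d : D) {L : List T} (hL : L.Nodup) {v : T} (hv : v ∈ L) :
    edgeSum (petal d L) (deltaEdges (targetSet D {v})) = 2 := by
  obtain ⟨L₁, L₂, rfl⟩ := List.append_of_mem hv
  have hnd := List.nodup_middle.1 hL
  simp only [List.nodup_cons, List.mem_append, not_or] at hnd
  rw [petal, List.map_append, List.append_assoc, List.map_cons, List.cons_append,
    ← List.cons_append,
    walkVec_append, edgeSum_add]
  have h2 : edgeSum (walkVec (Sum.inl v :: (L₂.map Sum.inl ++ [Sum.inr d])))
      (deltaEdges (targetSet D {v})) = 1 := by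
    have := edgeSum_walkVec_delta_leave (A := {v}) (L := []) (u := v)
      (l := L₂.map Sum.inl ++ [Sum.inr d]) rfl (by simp) ?_ (by simp)
    · simpa using this
    · intro a ha h
      simp only [targetSet, Set.image_singleton, Set.mem_singleton_iff] at h
      subst h
      simp [hnd.1.2] at ha
  have h1 : edgeSum (walkVec (Sum.inr d :: L₁.map Sum.inl ++ [Sum.inl v]))
      (deltaEdges (targetSet D {v})) = 1 := by
    -- The vertex `b` just before `v`, possibly the depot itself, is isolated so that the edge
    -- entering `v` can be split off.
    obtain ⟨l, b, hl⟩ : ∃ l b, Sum.inr d :: L₁.map Sum.inl = l ++ [b] :=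
      ⟨_, _, (List.dropLast_append_getLast (by simp)).symm⟩
    have hmem : ∀ a ∈ l ++ [b], a ∉ targetSet D {v} := by
      rw [← hl]
      intro a ha h
      simp only [targetSet, Set.image_singleton, Set.mem_singleton_iff] at h
      subst h
      simp [hnd.1.1] at ha
    rw [hl, List.append_assoc, List.singleton_append, walkVec_append, edgeSum_add,
      edgeSum_walkVec_delta_of_forall_notMem hmem, walkVec_cons_cons, edgeSum_add,
      edgeSum_edgeVec_delta_of_mem' (Set.mem_singleton v) (hmem b (by simp)),
      walkVec_singleton, edgeSum_zero]
    norm_num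
  rw [h1, h2, one_add_one_eq_two]

theorem edgeSum_edgeVec_between_of_notMem {A : Set T} {D' : Set D} {a b : T ⊕ D}
    (ha : a ∉ depotSet T D') (hb : b ∉ depotSet T D') :
    edgeSum (edgeVec s(a, b)) (betweenEdges (depotSet T D') (targetSet D A)) = 0 := by
  apply edgeSum_edgeVec_of_forall
  rintro e ⟨u, hu, v, hv, he⟩ h'
  rcases Sym2.eq_iff.1 (he.symm.trans h') with ⟨rfl, rfl⟩ | ⟨rfl, rfl⟩ <;> contradiction

/-- A petal uses no edges of other depots. -/
theorem edgeSum_petal_between_eq_zero {A : Set T} {D' : Set D} {d : D} (hd : d ∉ D')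
    (L : List T) :
    edgeSum (petal d L) (betweenEdges (depotSet T D') (targetSet D A)) = 0 := by
  have h : ∀ a ∈ Sum.inr d :: (L.map Sum.inl ++ [Sum.inr d]), a ∉ depotSet T D' := by
    intro a ha
    simp only [List.mem_cons, List.mem_append, List.mem_map, List.not_mem_nil, or_false] at ha
    rcases ha with rfl | ⟨v, hv, rfl⟩ | rfl <;> simp [depotSet, hd]
  exact edgeSum_walkVec_eq_zero fun a ha b hb =>
    edgeSum_edgeVec_between_of_notMem (h a ha) (h b hb)

/-- Only an upper bound, since `d` need not lie in `D'`. The indicator form lets the bounds for the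
two end edges of a petal be added. -/
theorem edgeSum_edgeVec_between_singleton_le (d : D) (v j : T) (D' : Set D) :
    edgeSum (edgeVec s(Sum.inr d, Sum.inl v)) (betweenEdges (depotSet T D') (targetSet D {j})) ≤
      Set.indicator {j} 1 v := by
  by_cases h : v = j
  · rw [Set.indicator_of_mem (by simpa using h)]
    by_cases h' : depotEdge d v ∈ betweenEdges (depotSet T D') (targetSet D {j})
    · exact (edgeSum_edgeVec_of_mem _ _ h').le
    · refine (edgeSum_edgeVec_of_forall fun e he he' => h' ?_).le.trans zero_le_one
      rwa [show depotEdge d v = e from Subtype.ext he'.symm]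
  · rw [Set.indicator_of_notMem (by simpa using h)]
    refine (edgeSum_edgeVec_of_forall ?_).le
    rintro e ⟨a, ⟨d', -, rfl⟩, b, ⟨w, rfl, rfl⟩, he⟩ h'
    rcases Sym2.eq_iff.1 (he.symm.trans h') with ⟨h1, h2⟩ | ⟨h1, h2⟩
    · exact h (Sum.inl_injective h2).symm
    · simp at h1

/-- A petal that visits another target than `j` uses at most one depot edge at `j`. -/
theorem edgeSum_petal_between_le (d : D) {L : List T} (hL : L.Nodup) {i j : T} (hi : i ∈ L)
    (hij : i ≠ j) (D' : Set D) :
    edgeSum (petal d L) (betweenEdges (depotSet T D') (targetSet D {j})) ≤ 1 := by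
  have hmid : ∀ M : List T, edgeSum (walkVec (M.map Sum.inl))
      (betweenEdges (depotSet T D') (targetSet D {j})) = 0 := fun M =>
    edgeSum_walkVec_eq_zero fun a ha b hb => by
      obtain ⟨u, -, rfl⟩ := List.mem_map.1 ha
      obtain ⟨v, -, rfl⟩ := List.mem_map.1 hb
      exact edgeSum_edgeVec_between_of_notMem (by simp [depotSet]) (by simp [depotSet])
  cases L with
  | nil => simp at hi
  | cons u L =>
    have h1 := edgeSum_edgeVec_between_singleton_le d u j D'
    -- Depot edges occur only at the first and the last target. A petal with one target misses `j`;
    -- otherwise the two end targets differ, so at most one of them is `j`.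
    rcases List.eq_nil_or_concat L with rfl | ⟨M, w, rfl⟩
    · have hu : u ≠ j := by simpa [List.mem_singleton.1 hi] using hij
      rw [Set.indicator_of_notMem (by simpa using hu)] at h1
      simp only [petal, List.map_cons, List.map_nil, List.cons_append, List.nil_append,
        walkVec_cons_cons, walkVec_singleton, edgeSum_add, edgeSum_zero]
      rw [Sym2.eq_swap (a := Sum.inl u)]
      linarith
    · have h2 := edgeSum_edgeVec_between_singleton_le d w j D'
      have huw : u ≠ w := by
        rintro rfl
        simp at hL
      have : petal d (u :: (M.concat w)) = edgeVec s(Sum.inr d, Sum.inl u) +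
          (walkVec ((u :: (M ++ [w])).map Sum.inl) + edgeVec s(Sum.inr d, Sum.inl w)) := by
        rw [petal, List.concat_eq_append, List.map_cons, List.cons_append, walkVec_cons_cons]
        congr 1
        have := walkVec_append (Sum.inl u :: M.map Sum.inl) (Sum.inl w) [Sum.inr d]
        rw [walkVec_cons_cons, walkVec_singleton, add_zero, Sym2.eq_swap] at this
        simpa using this
      rw [this, edgeSum_add, edgeSum_add, hmid]
      have h3 : Set.indicator {j} (1 : T → ℝ) u + Set.indicator {j} (1 : T → ℝ) w ≤ 1 := by
        by_cases hu : u = j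
        · have hw : w ≠ j := fun h => huw (hu.trans h.symm)
          simp [hu, hw]
        · by_cases hw : w = j <;> simp [hu, hw]
      linarith

end Walk

/-! ### Flowers satisfy all the constraints -/

section TourPart

variable {T D : Type*} [Fintype T] [Fintype D]

/-- `x` is a part of a feasible solution that visits exactly the targets of `W`. -/
structure IsTourPart (x : GEdge T D → ℝ) (W : Finset T) : Prop where
  exists_nat : ∀ e, ∃ n : ℕ, x e = n
  degree : ∀ v, edgeSum x (deltaEdges (targetSet D {v})) = 2 * (W : Set T).indicator 1 v
  subtour : ∀ A : Set T, ∀ i ∈ A, i ∈ W → 2 ≤ edgeSum x (deltaEdges (targetSet D A))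
  path_two : ∀ (j k : T) (hjk : j ≠ k) (D' : Set D),
    edgeSum x (betweenEdges (depotSet T D') (targetSet D {j})) +
      3 * x (targetEdge D j k hjk) +
      edgeSum x (betweenEdges (targetSet D {k}) (depotSet T D'ᶜ)) ≤
    2 * ((W : Set T).indicator 1 j + (W : Set T).indicator 1 k)
  path : ∀ (A : Set T), ∀ j ∈ A, ∀ k ∈ A, ∀ i ∈ A, i ≠ j → i ≠ k → i ∈ W → ∀ D' : Set D,
    edgeSum x (betweenEdges (depotSet T D') (targetSet D {j})) +
      edgeSum x (betweenEdges (targetSet D {k}) (depotSet T D'ᶜ)) + 1 ≤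
    edgeSum x (deltaEdges (targetSet D A))

namespace IsTourPart

theorem nonneg {x : GEdge T D → ℝ} {W : Finset T} (h : IsTourPart x W) : 0 ≤ x := fun e => by
  obtain ⟨n, hn⟩ := h.exists_nat e
  simp [hn]

theorem zero : IsTourPart (0 : GEdge T D → ℝ) ∅ where
  exists_nat _ := ⟨0, by simp⟩
  degree v := by simp [edgeSum_zero]
  subtour := by simp
  path_two j k h D' := by simp [edgeSum_zero]
  path := by simp

/-- The part that visits `i` supplies the constant in each cut inequality, and the other part
contributes no deficit: cuts are nonnegative and dominate the depot edges at `j` and `k` by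
`edgeSum_between_add_le`. -/
theorem add [DecidableEq T] {x x' : GEdge T D → ℝ} {W W' : Finset T} (h : IsTourPart x W)
    (h' : IsTourPart x' W') (hW : Disjoint W W') : IsTourPart (x + x') (W ∪ W') := by
  have hind : ∀ v, ((W ∪ W' : Finset T) : Set T).indicator (1 : T → ℝ) v =
      (W : Set T).indicator 1 v + (W' : Set T).indicator 1 v := fun v => by
    rw [Finset.coe_union, Set.indicator_union_of_disjoint (by exact_mod_cast hW)]
  have h0 := h.nonneg
  have h0' := h'.nonneg
  refine ⟨fun e => ?_, fun v => ?_, fun A i hiA hi => ?_, fun j k hjk D' => ?_,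
    fun A j hj k hk i hiA hij hik hi D' => ?_⟩
  · obtain ⟨n, hn⟩ := h.exists_nat e
    obtain ⟨n', hn'⟩ := h'.exists_nat e
    exact ⟨n + n', by simp [hn, hn']⟩
  · rw [edgeSum_add, h.degree, h'.degree, hind]
    ring
  · rw [edgeSum_add]
    rcases Finset.mem_union.1 hi with hi | hi
    · linarith [h.subtour A i hiA hi, edgeSum_nonneg h0' (deltaEdges (targetSet D A))]
    · linarith [h'.subtour A i hiA hi, edgeSum_nonneg h0 (deltaEdges (targetSet D A))]
  · have h1 := h.path_two j k hjk D'
    have h2 := h'.path_two j k hjk D'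
    simp only [edgeSum_add, hind, Pi.add_apply]
    linarith
  · simp only [edgeSum_add]
    rcases Finset.mem_union.1 hi with hi | hi
    · linarith [h.path A j hj k hk i hiA hij hik hi D', edgeSum_between_add_le h0' hj hk D']
    · linarith [h'.path A j hj k hk i hiA hij hik hi D', edgeSum_between_add_le h0 hj hk D']

end IsTourPart

theorem edgeSum_petal_degree_eq_zero (d : D) {L : List T} {v : T} (hv : v ∉ L) :
    edgeSum (petal d L) (deltaEdges (targetSet D {v})) = 0 :=
  edgeSum_petal_delta_eq_zero d fun _ hw h => hv (Set.mem_singleton_iff.1 h ▸ hw)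

/-- An upper bound for the value at the edge between two targets. -/
theorem two_mul_apply_targetEdge_le {x : GEdge T D → ℝ} (hx : 0 ≤ x) {j k : T} (hjk : j ≠ k) :
    2 * x (targetEdge D j k hjk) + edgeSum x (deltaEdges (targetSet D {j, k})) ≤
      edgeSum x (deltaEdges (targetSet D {j})) + edgeSum x (deltaEdges (targetSet D {k})) := by
  classical
  have h1 := sum_degree x {j, k}
  rw [Finset.sum_pair hjk, Finset.coe_pair] at h1
  have h2 := le_edgeSum hx (F := gammaEdges (targetSet D ({j, k} : Set T)))
    (e := targetEdge D j k hjk) ((targetEdge_mem_gammaEdges hjk).2 (by simp))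
  linarith

theorem isTourPart_petal [DecidableEq T] (d : D) {L : List T} (hL : L.Nodup) :
    IsTourPart (petal d L) L.toFinset := by
  have h0 : 0 ≤ petal d L := walkVec_nonneg _
  have hdeg : ∀ v, edgeSum (petal d L) (deltaEdges (targetSet D {v})) =
      2 * ((L.toFinset : Finset T) : Set T).indicator 1 v := fun v => by
    by_cases hv : v ∈ L
    · rw [edgeSum_petal_degree d hL hv, Set.indicator_of_mem (by simpa using hv)]
      simp
    · rw [edgeSum_petal_degree_eq_zero d hv, Set.indicator_of_notMem (by simpa using hv)]
      simp
  -- All depot edges of the petal are at `d`, which lies in just one of `D'` and its complement, so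
  -- only one of the two sums can be nonzero. That one is at most `1` because the petal visits
  -- another target.
  have hbetween : ∀ (D' : Set D) (j k i i' : T), i ∈ L → i ≠ j → i' ∈ L → i' ≠ k →
      edgeSum (petal d L) (betweenEdges (depotSet T D') (targetSet D {j})) +
      edgeSum (petal d L) (betweenEdges (targetSet D {k}) (depotSet T D'ᶜ)) ≤ 1 := by
    intro D' j k i i' hi hij hi' hik
    rw [betweenEdges_comm (targetSet D {k})]
    by_cases hd : d ∈ D'
    · rw [edgeSum_petal_between_eq_zero (D' := D'ᶜ) (by simpa using hd), add_zero]
      exact edgeSum_petal_between_le d hL hi hij D'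
    · rw [edgeSum_petal_between_eq_zero hd, zero_add]
      exact edgeSum_petal_between_le d hL hi' hik _
  refine ⟨exists_nat_walkVec _, hdeg, fun A i hiA hi => ?_, fun j k hjk D' => ?_,
    fun A j hj k hk i hiA hij hik hi D' => ?_⟩
  · exact two_le_edgeSum_petal d (List.mem_toFinset.1 hi) hiA
  -- If both targets are visited, the cut of `{j, k}` forces `x_jk ≤ 1`, and the bound is `1 + 3 =
  -- 4`. If only one is visited, then `x_jk ≤ 0` and its degree `2` suffices.
  · have h1 := two_mul_apply_targetEdge_le h0 hjk
    have hp := edgeSum_between_add_le h0 (Set.mem_singleton j) (Set.mem_singleton j) D'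
    have hq := edgeSum_between_add_le h0 (Set.mem_singleton k) (Set.mem_singleton k) D'
    have hp' := edgeSum_nonneg h0 (betweenEdges (targetSet D {j}) (depotSet T D'ᶜ))
    have hq' := edgeSum_nonneg h0 (betweenEdges (depotSet T D') (targetSet D {k}))
    rw [hdeg] at hp hq
    rw [hdeg, hdeg] at h1
    by_cases hj : j ∈ L
    · have h2 := two_le_edgeSum_petal d hj (A := {j, k}) (by simp)
      rw [Set.indicator_of_mem (a := j) (by simpa using hj), Pi.one_apply] at *
      by_cases hk : k ∈ L
      · have h3 := hbetween D' j k k j hk hjk.symm hj hjk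
        rw [Set.indicator_of_mem (by simpa using hk), Pi.one_apply] at *
        linarith
      · rw [Set.indicator_of_notMem (by simpa using hk)] at *
        linarith
    · rw [Set.indicator_of_notMem (a := j) (by simpa using hj)] at *
      by_cases hk : k ∈ L
      · have h2 := two_le_edgeSum_petal d hk (A := {j, k}) (by simp)
        rw [Set.indicator_of_mem (by simpa using hk), Pi.one_apply] at *
        linarith
      · have h2 := edgeSum_nonneg h0 (deltaEdges (targetSet D {j, k}))
        rw [Set.indicator_of_notMem (by simpa using hk)] at *
        linarith
  · rw [List.mem_toFinset] at hi
    linarith [hbetween D' j k i i hi hij hi hik, two_le_edgeSum_petal d hi hiA]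

/-- A tour part that visits all clusters is a feasible solution. -/
theorem IsTourPart.isFeasible {m : ℕ} {C : Fin m → Finset T} {x : GEdge T D → ℝ} {W : Finset T}
    (h : IsTourPart x W) (hC : ∀ a, ∃ v ∈ C a, v ∈ W) :
    IsFeasibleGMDTSP C (x, (W : Set T).indicator 1) := by
  classical
  have h0 := h.nonneg
  have hy0 : ∀ v, 0 ≤ (W : Set T).indicator (1 : T → ℝ) v := fun v =>
    Set.indicator_nonneg (fun _ _ => zero_le_one) v
  have hy1 : ∀ v, (W : Set T).indicator (1 : T → ℝ) v ≤ 1 := fun v =>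
    Set.indicator_le_self' (fun _ _ => zero_le_one) v
  have hy : ∀ v, (W : Set T).indicator (1 : T → ℝ) v = 0 ∨
      (W : Set T).indicator (1 : T → ℝ) v = 1 ∧ v ∈ W := fun v => by
    by_cases hv : v ∈ W <;> simp [hv]
  refine ⟨h.degree, fun a => ?_, fun A i hi => ?_, fun j k hjk D' _ => h.path_two j k hjk D',
    fun j k hjk A hj hk i hi D' _ => ?_, fun e he => ?_, fun e he => ?_, fun i => ?_⟩
  · obtain ⟨v, hvC, hvW⟩ := hC a
    have := Finset.single_le_sum (f := (W : Set T).indicator (1 : T → ℝ)) (fun v _ => hy0 v) hvC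
    rwa [Set.indicator_of_mem (by simpa using hvW), Pi.one_apply] at this
  · rcases hy i with h1 | ⟨h1, hiW⟩
    · simp only [h1, mul_zero]
      exact edgeSum_nonneg h0 _
    · simp only [h1, mul_one]
      exact h.subtour _ i hi hiW
  -- By the handshake identity on `S' ∪ {j, k}`, the path constraint says that the depot edges at
  -- `j` and `k` plus `y_i` are at most the cut. For `y_i = 1` this is the field `path`; for `y_i =
  -- 0` it is `edgeSum_between_add_le`.
  · have hA : (A : Set T) ∪ {j, k} = ((insert j (insert k A) : Finset T) : Set T) := by
      ext v
      simp
    have hsum := sum_degree x (insert j (insert k A))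
    rw [Finset.sum_insert (by simp [hjk, hj]), Finset.sum_insert hk, ← hA] at hsum
    simp only [h.degree] at hsum
    have hij : i ≠ j := fun h => hj (h ▸ hi)
    have hik : i ≠ k := fun h => hk (h ▸ hi)
    have hj' : j ∈ (A : Set T) ∪ {j, k} := by simp
    have hk' : k ∈ (A : Set T) ∪ {j, k} := by simp
    have hi' : i ∈ (A : Set T) ∪ {j, k} := by simp [hi]
    dsimp only
    rcases hy i with h1 | ⟨h1, hiW⟩
    · linarith [edgeSum_between_add_le h0 hj' hk' D']
    · linarith [h.path _ j hj' k hk' i hi' hij hik hiW D']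
  · induction e using GEdge.cases with
    | hD d v => exact absurd he depotEdge_mem_gammaEdges
    | hT j k hjk =>
      have h1 := two_mul_apply_targetEdge_le h0 hjk
      have h2 := edgeSum_nonneg h0 (deltaEdges (targetSet D {j, k}))
      rw [h.degree, h.degree] at h1
      obtain ⟨n, hn⟩ := h.exists_nat (targetEdge D j k hjk)
      have hle : x (targetEdge D j k hjk) ≤ 1 := by
        rcases hy j with hj | ⟨hj, hjW⟩
        · linarith [hy1 k]
        · linarith [hy1 k, h.subtour {j, k} j (by simp) hjW]
      simp only [hn] at hle ⊢
      norm_cast at hle ⊢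
      omega
  · induction e using GEdge.cases with
    | hT j k hjk => exact absurd he (targetEdge_mem_betweenEdges hjk)
    | hD d v =>
      have h1 := le_edgeSum h0 (F := deltaEdges (targetSet D {v})) (e := depotEdge d v)
        (depotEdge_mem_deltaEdges.2 rfl)
      obtain ⟨n, hn⟩ := h.exists_nat (depotEdge d v)
      have hle : x (depotEdge d v) ≤ 2 := by
        rw [h.degree] at h1
        linarith [hy1 v]
      simp only [hn] at hle ⊢
      norm_cast at hle ⊢
      omega
  · rcases hy i with h | ⟨h, -⟩
    · exact Or.inl h
    · exact Or.inr h

/-- The petal of the depot `d` that visits the targets of `L`, and for every target of `U` a petal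
of the depot `d'` that only visits this target. -/
noncomputable def petalsVec (d d' : D) (L : List T) (U : Finset T) : GEdge T D → ℝ :=
  petal d L + ∑ u ∈ U, petal d' [u]

theorem isTourPart_petalsVec [DecidableEq T] (d d' : D) {L : List T} (hL : L.Nodup)
    {U : Finset T} (hU : ∀ v ∈ U, v ∉ L) :
    IsTourPart (petalsVec d d' L U) (L.toFinset ∪ U) := by
  apply (isTourPart_petal d hL).add
  · clear hU
    induction U using Finset.induction_on with
    | empty => simpa using IsTourPart.zero
    | insert v U hv ih =>
      rw [Finset.sum_insert hv, Finset.insert_eq]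
      have h1 : IsTourPart (petal d' [v]) {v} := by
        simpa using isTourPart_petal d' (List.nodup_singleton v)
      exact h1.add ih (by simpa using hv)
  · rw [Finset.disjoint_right]
    intro v hv
    simpa using hU v hv

theorem edgeSum_sum {ι : Type*} (U : Finset ι) (x : ι → GEdge T D → ℝ) (F : Set (GEdge T D)) :
    edgeSum (∑ u ∈ U, x u) F = ∑ u ∈ U, edgeSum (x u) F := by
  classical
  induction U using Finset.induction_on with
  | empty => simp [edgeSum_zero]
  | insert v U hv ih => rw [Finset.sum_insert hv, Finset.sum_insert hv, edgeSum_add, ih]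

theorem edgeSum_petalsVec_delta {A : Set T} (d d' : D) {L : List T} {U : Finset T}
    (hU : ∀ v ∈ U, v ∉ A) :
    edgeSum (petalsVec d d' L U) (deltaEdges (targetSet D A)) =
      edgeSum (petal d L) (deltaEdges (targetSet D A)) := by
  rw [petalsVec, edgeSum_add, edgeSum_sum, add_eq_left]
  refine Finset.sum_eq_zero fun u hu => edgeSum_petal_delta_eq_zero d' ?_
  simpa using hU u hu

end TourPart

/-! ### A facet criterion by linear functionals -/

section Facet

variable {V : Type*} [NormedAddCommGroup V] [NormedSpace ℝ V] [FiniteDimensional ℝ V]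

/-- A criterion for facets: every linear functional that is constant on the tight points of `X`
agrees on `X` with a multiple of the given functional, up to a constant. -/
theorem isFacet_convexHull {X : Set V} {f : V → ℝ} {b : ℝ} (g : V →L[ℝ] ℝ) (c₀ : ℝ)
    (hf : ∀ z, f z = g z + c₀) (hvalid : ∀ z ∈ convexHull ℝ X, b ≤ f z)
    {p₀ z₀ : V} (hp₀ : p₀ ∈ X) (hfp₀ : f p₀ = b) (hz₀ : z₀ ∈ X) (hfz₀ : f z₀ ≠ b)
    (h : ∀ ℓ : V →ₗ[ℝ] ℝ, (∀ z ∈ X, f z = b → ℓ z = ℓ p₀) →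
      ∃ t c : ℝ, ∀ z ∈ X, ℓ z = t * f z + c) :
    IsFacet (convexHull ℝ X) {z | z ∈ convexHull ℝ X ∧ f z = b} := by
  have hXP := subset_convexHull ℝ X
  set F : Set V := {z | z ∈ convexHull ℝ X ∧ f z = b} with hF
  have hp₀F : p₀ ∈ F := ⟨hXP hp₀, hfp₀⟩
  -- Exposed faces are sets of maximizers, whereas `F` minimizes `g`.
  refine ⟨fun _ => ⟨-g, ?_⟩, ⟨p₀, hp₀F⟩, ?_⟩
  · ext z
    simp only [hF]
    constructor
    · rintro ⟨hz, hfz⟩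
      refine ⟨hz, fun y hy => ?_⟩
      have := hvalid y hy
      rw [hf] at this hfz
      simp only [neg_apply]
      linarith
    · rintro ⟨hz, hmax⟩
      refine ⟨hz, le_antisymm ?_ (hvalid z hz)⟩
      have := hmax p₀ (hXP hp₀)
      rw [hf] at hfp₀ ⊢
      simp only [neg_apply] at this
      linarith
  · have hFP : F ⊆ convexHull ℝ X := fun z hz => hz.1
    have hg : vectorSpan ℝ F ≤ LinearMap.ker g.toLinearMap := by
      rw [vectorSpan_def, Submodule.span_le]
      rintro _ ⟨y, hy, z, hz, rfl⟩
      have h1 := hy.2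
      have h2 := hz.2
      rw [hf] at h1 h2
      simp only [vsub_eq_sub, SetLike.mem_coe, LinearMap.mem_ker,
        ContinuousLinearMap.coe_coe, map_sub]
      linarith
    have hw : z₀ - p₀ ∉ vectorSpan ℝ F := by
      intro hmem
      have := hg hmem
      simp only [LinearMap.mem_ker, ContinuousLinearMap.coe_coe, map_sub] at this
      apply hfz₀
      rw [← hfp₀, hf, hf]
      linarith
    -- Otherwise some functional vanishes on the right hand side but not on the left. By `h` it is
    -- `t * f + c` on `X`; equal values at `z₀` and `p₀` force `t = 0`, so it is constant on `X` and
    -- vanishes on the left too.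
    have heq : vectorSpan ℝ (convexHull ℝ X) = vectorSpan ℝ F ⊔ ℝ ∙ (z₀ - p₀) := by
      apply le_antisymm
      · by_contra hnot
        obtain ⟨x, hx, hxn⟩ := SetLike.not_le_iff_exists.1 hnot
        obtain ⟨ℓ, hℓx, hℓ⟩ := Submodule.exists_le_ker_of_notMem hxn
        have hconst : ∀ z ∈ X, f z = b → ℓ z = ℓ p₀ := by
          intro z hz hfz
          have : z - p₀ ∈ vectorSpan ℝ F := vsub_mem_vectorSpan ℝ ⟨hXP hz, hfz⟩ hp₀F
          have := hℓ (Submodule.mem_sup_left this)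
          rwa [LinearMap.mem_ker, map_sub, sub_eq_zero] at this
        obtain ⟨t, c, htc⟩ := h ℓ hconst
        have h1 := hℓ (Submodule.mem_sup_right (Submodule.mem_span_singleton_self (z₀ - p₀)))
        rw [LinearMap.mem_ker, map_sub, htc _ hz₀, htc _ hp₀, hfp₀] at h1
        have ht : t = 0 := by
          have : t * (f z₀ - b) = 0 := by linarith
          exact (mul_eq_zero.1 this).resolve_right (sub_ne_zero.2 hfz₀)
        apply hℓx
        have hle : vectorSpan ℝ (convexHull ℝ X) ≤ LinearMap.ker ℓ := by
          rw [← direction_affineSpan, affineSpan_convexHull, direction_affineSpan,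
            vectorSpan_def, Submodule.span_le]
          rintro _ ⟨y, hy, z, hz, rfl⟩
          simp [htc y hy, htc z hz, ht]
        exact hle hx
      · refine sup_le (vectorSpan_mono ℝ hFP) ?_
        rw [Submodule.span_singleton_le_iff_mem]
        exact vsub_mem_vectorSpan ℝ (hXP hz₀) (hXP hp₀)
    have hw0 : z₀ - p₀ ≠ 0 := fun h0 => hw (h0 ▸ Submodule.zero_mem _)
    have hinf : vectorSpan ℝ F ⊓ ℝ ∙ (z₀ - p₀) = ⊥ := by
      rw [← disjoint_iff]
      exact (Submodule.disjoint_span_singleton' hw0).2 hw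
    have := Submodule.finrank_sup_add_finrank_inf_eq (vectorSpan ℝ F) (ℝ ∙ (z₀ - p₀))
    rw [hinf, finrank_bot, finrank_span_singleton hw0, add_zero] at this
    rw [heq, this]

end Facet

/-! ### Functionals constant on tight flowers -/

section Cost

variable {T D : Type*}

theorem petal_singleton (d : D) (v : T) :
    petal d [v] = (2 : ℝ) • edgeVec s(Sum.inr d, Sum.inl v) := by
  simp only [petal, List.map_cons, List.map_nil, List.cons_append, List.nil_append,
    walkVec_cons_cons, walkVec_singleton, add_zero]
  rw [Sym2.eq_swap (a := Sum.inl v), two_smul]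

theorem petal_cons_cons (d : D) (v w : T) (L : List T) :
    petal d (v :: w :: L) + edgeVec s(Sum.inr d, Sum.inl w) =
      petal d (w :: L) + edgeVec s(Sum.inl v, Sum.inl w) + edgeVec s(Sum.inr d, Sum.inl v) := by
  simp only [petal, List.map_cons, List.cons_append, walkVec_cons_cons]
  abel

theorem petal_concat (d : D) (L : List T) (s : T) :
    petal d (L ++ [s]) = walkVec (Sum.inr d :: (L ++ [s]).map Sum.inl) +
      edgeVec s(Sum.inr d, Sum.inl s) := by
  have := walkVec_append (Sum.inr d :: L.map Sum.inl) (Sum.inl s) [Sum.inr d]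
  rw [walkVec_cons_cons, walkVec_singleton, add_zero, Sym2.eq_swap] at this
  simpa [petal] using this

theorem petal_concat_concat (d : D) (L : List T) (s r : T) :
    petal d (L ++ [s] ++ [r]) + edgeVec s(Sum.inr d, Sum.inl s) =
      petal d (L ++ [s]) + edgeVec s(Sum.inl s, Sum.inl r) +
        edgeVec s(Sum.inr d, Sum.inl r) := by
  have := walkVec_append (Sum.inr d :: L.map Sum.inl) (Sum.inl (β := D) s) [Sum.inl r]
  rw [walkVec_cons_cons, walkVec_singleton, add_zero] at this
  rw [petal_concat, petal_concat]
  simp only [List.map_append, List.map_cons, List.map_nil, List.append_assoc, List.cons_append,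
    List.nil_append] at this ⊢
  rw [this]
  abel

theorem petal_cons_concat (d : D) (s : T) (L : List T) (s' : T) :
    petal d (s :: (L ++ [s'])) = edgeVec s(Sum.inr d, Sum.inl s) +
      edgeVec s(Sum.inr d, Sum.inl s') + walkVec ((s :: (L ++ [s'])).map Sum.inl) := by
  rw [← List.cons_append, petal_concat, List.cons_append, List.map_cons, walkVec_cons_cons]
  abel

variable [Fintype T] [Fintype D]

/-- A linear functional on the edge space, in terms of its values at the edges. -/
theorem linearMap_eq_sum (φ : (GEdge T D → ℝ) →ₗ[ℝ] ℝ) (x : GEdge T D → ℝ) :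
    φ x = ∑ e, φ (edgeVec e.1) * x e := by
  classical
  rw [LinearMap.pi_apply_eq_sum_univ φ x]
  refine Finset.sum_congr rfl fun e _ => ?_
  rw [smul_eq_mul, mul_comm]
  congr 2
  ext e'
  by_cases h : e = e'
  · subst h
    simp [edgeVec_apply_eq]
  · rw [edgeVec_apply_ne _ _ fun h' => h (Subtype.ext h'.symm), if_neg h]

/-- A linear functional whose values at the edges are `σ u + σ v`, up to a constant for the edges
within `S`, is a combination of the degrees and the size of the cut `δ(S)`. -/
theorem linearMap_eq_degree_add_cut (φ : (GEdge T D → ℝ) →ₗ[ℝ] ℝ) (S : Finset T) (σ : T → ℝ)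
    (t : ℝ) (hD : ∀ d v, φ (edgeVec s(Sum.inr d, Sum.inl v)) = σ v)
    (hR : ∀ u v, u ≠ v → u ∉ S → φ (edgeVec s(Sum.inl u, Sum.inl v)) = σ u + σ v)
    (hS : ∀ u v, u ≠ v → u ∈ S → v ∈ S →
      φ (edgeVec s(Sum.inl u, Sum.inl v)) = σ u + σ v - 2 * t) :
    ∃ τ : T → ℝ, ∀ x, φ x = ∑ v, τ v * edgeSum x (deltaEdges (targetSet D {v})) +
      t * edgeSum x (deltaEdges (targetSet D (S : Set T))) := by
  classical
  have key : ∀ x, φ x = ∑ v, σ v * edgeSum x (deltaEdges (targetSet D {v})) -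
      2 * t * edgeSum x (gammaEdges (targetSet D (S : Set T))) := by
    intro x
    rw [linearMap_eq_sum, sum_mul_degree, edgeSum, Finset.mul_sum, ← Finset.sum_sub_distrib]
    refine Finset.sum_congr rfl fun e _ => ?_
    induction e using GEdge.cases with
    | hD d v =>
      rw [sum_indicator_degree_depotEdge, Set.indicator_of_notMem depotEdge_mem_gammaEdges,
        mul_zero, sub_zero]
      exact congrArg (· * _) (hD d v)
    | hT u v h =>
      rw [sum_indicator_degree_targetEdge, Set.indicator_apply, targetEdge_mem_gammaEdges]
      change φ (edgeVec s(Sum.inl u, Sum.inl v)) * _ = _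
      by_cases hu : u ∈ S
      · by_cases hv : v ∈ S
        · rw [hS u v h hu hv, if_pos ⟨hu, hv⟩]
          ring
        · rw [Sym2.eq_swap, hR v u h.symm hv, if_neg (by simp [hv])]
          ring
      · rw [hR u v h hu, if_neg (by simp [hu])]
        ring
  -- The handshake identity replaces `-2t x(γ(S))` by `t x(δ(S))` minus `t` times the degrees in
  -- `S`.
  refine ⟨fun v => σ v - if v ∈ S then t else 0, fun x => ?_⟩
  have h := sum_degree x S
  simp only [sub_mul, Finset.sum_sub_distrib, ite_mul, zero_mul, Finset.sum_ite_mem,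
    Finset.univ_inter, ← Finset.mul_sum]
  rw [key, h]
  ring

/-- A linear functional on the edge space that has the same value at all the solutions that visit
every target, with the targets of `S` visited consecutively, is a combination of the degrees and
the size of the cut `δ(S)`. -/
theorem exists_eq_degree_add_cut [DecidableEq T] [Nonempty D] (φ : (GEdge T D → ℝ) →ₗ[ℝ] ℝ)
    (S : Finset T) (hT : 3 ≤ Fintype.card T) (hS : 2 ≤ S.card) (c : ℝ)
    (h : ∀ (d d' : D) (Y E : List T), (Y ++ E).Nodup → Y.toFinset = S →
      φ (petalsVec d d' (Y ++ E) (Finset.univ \ (Y ++ E).toFinset)) = c) :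
    ∃ (τ : T → ℝ) (t : ℝ), ∀ x, φ x = ∑ v, τ v * edgeSum x (deltaEdges (targetSet D {v})) +
      t * edgeSum x (deltaEdges (targetSet D (S : Set T))) := by
  set a : D → T → ℝ := fun d v => φ (edgeVec s(Sum.inr d, Sum.inl v)) with ha
  set b : T → T → ℝ := fun u v => φ (edgeVec s(Sum.inl u, Sum.inl v)) with hb
  have hbsymm : ∀ u v, b u v = b v u := fun u v => by simp only [hb]; rw [Sym2.eq_swap]
  -- Exchange: `r` has its own petal at `d'`, or is appended to the main petal after `s`.
  have append : ∀ (d d' : D) (Y E L : List T) (s r : T), (L ++ [s] ++ [r]).Nodup →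
      Y.toFinset = S → L ++ [s] = Y ++ E → a d s + 2 * a d' r = b s r + a d r := by
    intro d d' Y E L s r hnd hY hYE
    have h1 := h d d' Y E (hYE ▸ hnd.of_append_left) hY
    have h2 := h d d' Y (E ++ [r]) (by rwa [← List.append_assoc, ← hYE]) hY
    rw [← List.append_assoc, ← hYE] at h2
    rw [← hYE] at h1
    have hr : r ∉ L ++ [s] := fun h => List.disjoint_of_nodup_append hnd h (by simp)
    have hU : Finset.univ \ (L ++ [s]).toFinset =
        insert r (Finset.univ \ (L ++ [s] ++ [r]).toFinset) := by
      ext v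
      by_cases hv : v = r
      · subst hv
        simpa [and_comm] using hr
      · simp [hv]
    rw [petalsVec, hU, Finset.sum_insert (by simp), petal_singleton] at h1
    rw [petalsVec] at h2
    have h3 := congrArg φ (petal_concat_concat d L s r)
    simp only [map_add, map_smul, smul_eq_mul] at h1 h2 h3
    simp only [ha, hb]
    linarith
  -- Moving `v` from the front of a tour of `S` to its end, next to `u`, does not change the value;
  -- the common part `w, …, u` cancels.
  have triple : ∀ (d : D) (u v w : T), u ∈ S → v ∈ S → w ∈ S → u ≠ v → v ≠ w → u ≠ w →
      b v w - a d w = b u v - a d u := by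
    intro d u v w hu hv hw huv hvw huw
    set l := (S \ {u, v, w}).toList with hl
    have hlnd : l.Nodup := Finset.nodup_toList _
    have hlu : u ∉ l := by simp [hl]
    have hlv : v ∉ l := by simp [hl]
    have hlw : w ∉ l := by simp [hl]
    have hl' : l.toFinset = S \ {u, v, w} := Finset.toList_toFinset _
    have e1 : (v :: w :: (l ++ [u])).toFinset = S := by
      ext x
      simp only [List.toFinset_cons, List.toFinset_append, hl', Finset.mem_insert,
        Finset.mem_union, Finset.mem_sdiff, List.toFinset_nil, Finset.notMem_empty,
        Finset.mem_singleton]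
      constructor
      · rintro (rfl | rfl | ⟨hx, -⟩ | rfl | hx)
        all_goals first | assumption | contradiction
      · tauto
    have e2 : (w :: l ++ [u] ++ [v]).toFinset = S := by
      rw [← e1]
      ext x
      simp
      tauto
    have n1 : (v :: w :: (l ++ [u])).Nodup := by
      simp [List.nodup_append, hlnd, hlv, hlw, huv.symm, hvw, huw.symm]
      rintro x hx rfl
      exact hlu hx
    have n2 : (w :: l ++ [u] ++ [v]).Nodup := by
      refine (List.perm_append_singleton v _).symm.nodup ?_
      simpa using n1
    have h1 := h d d _ [] (by simpa using n1) e1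
    have h2 := h d d _ [] (by simpa using n2) e2
    rw [List.append_nil, e1, petalsVec, map_add] at h1
    rw [List.append_nil, e2, petalsVec, map_add] at h2
    have h3 := congrArg φ (petal_cons_cons d v w (l ++ [u]))
    have h4 := congrArg φ (petal_concat_concat d (w :: l) u v)
    simp only [map_add, List.cons_append] at h1 h2 h3 h4
    simp only [ha, hb]
    linarith
  obtain ⟨d₀⟩ := ‹Nonempty D›
  -- The depot costs do not depend on the depot. If `S` is everything, changing the depot of a whole
  -- tour only compares sums over its two end targets, and a third target separates the summands.
  -- Otherwise a target outside `S` can be moved between petals.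
  have hconst : ∀ d v, a d v = a d₀ v := by
    by_cases hSu : S = Finset.univ
    · have pair : ∀ d (s s' : T), s ≠ s' → a d s + a d s' = a d₀ s + a d₀ s' := by
        intro d s s' hss
        set l := (S \ {s, s'}).toList with hl
        have hlnd : l.Nodup := Finset.nodup_toList _
        have hls : s ∉ l := by simp [hl]
        have hls' : s' ∉ l := by simp [hl]
        have e1 : (s :: (l ++ [s'])).toFinset = S := by
          have hl' : l.toFinset = S \ {s, s'} := Finset.toList_toFinset _
          ext x
          simp only [List.toFinset_cons, List.toFinset_append, hl', hSu, Finset.mem_insert,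
            Finset.mem_union, Finset.mem_sdiff, List.toFinset_nil, Finset.notMem_empty,
            Finset.mem_singleton, Finset.mem_univ]
          tauto
        have n1 : (s :: (l ++ [s'])).Nodup := by
          simp [List.nodup_append, hlnd, hls, hss]
          rintro x hx rfl
          exact hls' hx
        have h1 := h d d₀ _ [] (by simpa using n1) e1
        have h2 := h d₀ d₀ _ [] (by simpa using n1) e1
        rw [List.append_nil, e1, petalsVec, petal_cons_concat] at h1 h2
        simp only [map_add] at h1 h2
        simp only [ha]
        linarith
      intro d v
      obtain ⟨u, hu, w, hw, huw⟩ : ∃ u, u ≠ v ∧ ∃ w, w ≠ v ∧ u ≠ w := by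
        have hcard : 1 < (Finset.univ.erase v).card := by
          rw [Finset.card_erase_of_mem (Finset.mem_univ v), Finset.card_univ]
          omega
        obtain ⟨u, hu, w, hw, huw⟩ := Finset.one_lt_card.1 hcard
        exact ⟨u, Finset.ne_of_mem_erase hu, w, Finset.ne_of_mem_erase hw, huw⟩
      linarith [pair d u v hu, pair d w v hw, pair d u w huw]
    · obtain ⟨r, hr⟩ : ∃ r, r ∉ S := by
        by_contra! hall
        exact hSu (Finset.eq_univ_of_forall hall)
      have last : ∀ s ∈ S, ∀ r, r ∉ S → ∀ d d', a d s + 2 * a d' r = b s r + a d r := by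
        intro s hs r hr d d'
        refine append d d' ((S.erase s).toList ++ [s]) [] (S.erase s).toList s r ?_ ?_ (by simp)
        · refine (List.perm_append_singleton r _).symm.nodup ?_
          refine List.nodup_cons.2 ⟨?_, (List.perm_append_singleton s _).symm.nodup ?_⟩
          · simp only [List.mem_append, Finset.mem_toList, Finset.mem_erase, List.mem_singleton]
            rintro (⟨-, h⟩ | rfl) <;> contradiction
          · exact List.nodup_cons.2 ⟨by simp, Finset.nodup_toList _⟩
        · rw [List.toFinset_append, Finset.toList_toFinset]
          ext x
          by_cases hx : x = s <;> simp [hx, hs]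
      obtain ⟨s, hs⟩ : S.Nonempty := Finset.card_pos.1 (by omega)
      have hconstR : ∀ r, r ∉ S → ∀ d, a d r = a d₀ r := fun r hr d => by
        linarith [last s hs r hr d d, last s hs r hr d d₀]
      intro d v
      by_cases hv : v ∈ S
      · linarith [last v hv r hr d d, last v hv r hr d₀ d₀, hconstR r hr d]
      · exact hconstR v hv d
  have hR : ∀ u v, u ≠ v → u ∉ S → b u v = a d₀ u + a d₀ v := by
    intro u v huv hu
    obtain ⟨s, hs⟩ : S.Nonempty := Finset.card_pos.1 (by omega)
    by_cases hv : v ∈ S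
    · have := append d₀ d₀ ((S.erase v).toList ++ [v]) [] (S.erase v).toList v u ?_ ?_ (by simp)
      · linarith [hbsymm u v]
      · refine (List.perm_append_singleton u _).symm.nodup ?_
        refine List.nodup_cons.2 ⟨?_, (List.perm_append_singleton v _).symm.nodup ?_⟩
        · simp [hu, huv]
        · exact List.nodup_cons.2 ⟨by simp, Finset.nodup_toList _⟩
      · rw [List.toFinset_append, Finset.toList_toFinset]
        ext x
        by_cases hx : x = v <;> simp [hx, hv]
    · have := append d₀ d₀ S.toList [u] S.toList u v ?_ (Finset.toList_toFinset S) rfl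
      · linarith
      · refine (List.perm_append_singleton v _).symm.nodup ?_
        refine List.nodup_cons.2 ⟨?_, (List.perm_append_singleton u _).symm.nodup ?_⟩
        · simp [hv, huv.symm]
        · exact List.nodup_cons.2 ⟨by simp [hu], Finset.nodup_toList _⟩
  obtain ⟨s₁, hs₁, s₂, hs₂, hs₁₂⟩ := Finset.one_lt_card.1 hS
  -- The reduced cost `b u v - a u - a v` agrees on adjacent edges within `S` by `triple`, and any
  -- two such edges are linked by a chain of adjacent ones. The coefficient `t` is minus half of the
  -- common value.
  have hSS : ∀ u v, u ≠ v → u ∈ S → v ∈ S →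
      b u v - a d₀ u - a d₀ v = b s₁ s₂ - a d₀ s₁ - a d₀ s₂ := by
    have move : ∀ u v w, u ∈ S → v ∈ S → w ∈ S → u ≠ v → v ≠ w →
        b u v - a d₀ u - a d₀ v = b v w - a d₀ v - a d₀ w := by
      intro u v w hu hv hw huv hvw
      by_cases huw : u = w
      · subst huw
        linarith [hbsymm u v]
      · linarith [triple d₀ u v w hu hv hw huv hvw huw]
    intro u v huv hu hv
    by_cases h1 : v = s₁
    · subst h1
      exact move u v s₂ hu hv hs₂ huv hs₁₂
    · rw [move u v s₁ hu hv hs₁ huv h1, move v s₁ s₂ hv hs₁ hs₂ h1 hs₁₂]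
  obtain ⟨τ, hτ⟩ := linearMap_eq_degree_add_cut φ S (a d₀)
    (-(b s₁ s₂ - a d₀ s₁ - a d₀ s₂) / 2) hconst hR
    fun u v huv hu hv => by linarith [hSS u v huv hu hv]
  exact ⟨τ, _, hτ⟩

end Cost

/-! ### The generalized sub-tour elimination constraint -/

section Gsec

variable {T D : Type*} [Fintype T] [Fintype D]

/-- The linear part of the left hand side of the generalized sub-tour elimination constraint. -/
noncomputable def gsecLinear (D : Type*) [Fintype D] (S : Finset T) (β : ℝ) (i : T) :
    GSpace T D →ₗ[ℝ] ℝ where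
  toFun z := edgeSum z.1 (deltaEdges (targetSet D (S : Set T))) - β * z.2 i
  map_add' z z' := by
    simp only [Prod.fst_add, Prod.snd_add, Pi.add_apply, edgeSum_add]
    ring
  map_smul' r z := by
    simp only [Prod.smul_fst, Prod.smul_snd, Pi.smul_apply, edgeSum_smul, smul_eq_mul,
      RingHom.id_apply]
    ring

theorem gsecLHS_eq {m : ℕ} (C : Fin m → Finset T) (S : Finset T) (i : T) (z : GSpace T D) :
    gsecLHS C S i z = gsecLinear D S (betaBar C S) i z + betaBar C S := by
  simp only [gsecLHS, gsecLinear, LinearMap.coe_mk, AddHom.coe_mk]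
  ring

omit [Fintype T] in
theorem betaBar_eq_zero_of_subset {m : ℕ} {C : Fin m → Finset T} {S : Finset T} {a : Fin m}
    (ha : C a ⊆ S) : betaBar C S = 0 := by
  rw [betaBar, if_neg]
  rw [clusterCount, Set.ncard_eq_zero]
  exact fun h => (h.subset ha : a ∈ (∅ : Set (Fin m)))

omit [Fintype T] in
theorem betaBar_eq_two_of_forall_not_subset {m : ℕ} {C : Fin m → Finset T} {S : Finset T}
    (hS : ∀ a, ¬C a ⊆ S) : betaBar C S = 2 := by
  rw [betaBar, if_pos]
  rw [clusterCount, Set.ncard_eq_zero, Set.eq_empty_iff_forall_notMem]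
  exact hS

/-- The generalized sub-tour elimination constraint holds for feasible solutions. -/
theorem IsFeasibleGMDTSP.two_le_gsecLHS {m : ℕ} {C : Fin m → Finset T} {z : GSpace T D}
    (hz : IsFeasibleGMDTSP C z) {S : Finset T} {i : T} (hi : i ∈ S) : 2 ≤ gsecLHS C S i z := by
  by_cases hS : ∃ a, C a ⊆ S
  · obtain ⟨a, ha⟩ := hS
    rw [gsecLHS, betaBar_eq_zero_of_subset ha, zero_mul, add_zero]
    obtain ⟨v, hv, hy⟩ : ∃ v ∈ C a, z.2 v = 1 := by
      by_contra! hno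
      have h0 : ∑ v ∈ C a, z.2 v = 0 := Finset.sum_eq_zero fun v hv =>
        (hz.integer_y v).resolve_right (hno v hv)
      have := hz.assignment a
      linarith
    have := hz.subtour S v (ha hv)
    linarith
  · push Not at hS
    rw [gsecLHS, betaBar_eq_two_of_forall_not_subset hS]
    linarith [hz.subtour S i hi]

theorem gsec_valid {m : ℕ} (C : Fin m → Finset T) {S : Finset T} {i : T} (hi : i ∈ S) :
    IsValidFor (gmdtspPolytope D C) (gsecLHS C S i) 2 := by
  have hconv : Convex ℝ {z : GSpace T D | 2 - betaBar C S ≤ gsecLinear D S (betaBar C S) i z} :=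
    convex_halfSpace_ge (gsecLinear D S (betaBar C S) i).isLinear _
  intro z hz
  have hsub : gmdtspPolytope D C ⊆ _ := convexHull_min (fun z (hz : IsFeasibleGMDTSP C z) => by
    have := hz.two_le_gsecLHS hi
    rw [gsecLHS_eq] at this
    exact sub_le_iff_le_add.2 this) hconv
  have := hsub hz
  rw [gsecLHS_eq]
  exact sub_le_iff_le_add.1 this

/-- A linear functional that is constant on the feasible solutions for which the generalized
sub-tour elimination constraint is tight is a multiple of its left hand side on all feasible
solutions, up to a constant. -/
theorem exists_eq_mul_gsecLHS_add [DecidableEq T] [Nonempty D] {m : ℕ} (C : Fin m → Finset T)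
    (hC_nonempty : ∀ h, (C h).Nonempty) (hT : 3 ≤ Fintype.card T)
    (S : Finset T) (i : T) (hi : i ∈ S) (hS : 2 ≤ S.card)
    (ℓ : GSpace T D →ₗ[ℝ] ℝ) (c : ℝ)
    (hℓ : ∀ z, IsFeasibleGMDTSP C z → gsecLHS C S i z = 2 → ℓ z = c) :
    ∃ t c' : ℝ, ∀ z, IsFeasibleGMDTSP C z → ℓ z = t * gsecLHS C S i z + c' := by
  obtain ⟨d₀⟩ := id ‹Nonempty D›
  set φ : (GEdge T D → ℝ) →ₗ[ℝ] ℝ := ℓ ∘ₗ LinearMap.inl ℝ _ _ with hφ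
  set ψ : (T → ℝ) →ₗ[ℝ] ℝ := ℓ ∘ₗ LinearMap.inr ℝ _ _ with hψ
  have hsplit : ∀ z, ℓ z = φ z.1 + ψ z.2 := fun z => by
    simp [hφ, hψ, ← map_add]
  obtain ⟨τ, t, hτ⟩ := exists_eq_degree_add_cut φ S hT hS
    (c - ψ (((Finset.univ : Finset T) : Set T).indicator 1)) (by
      intro d d' Y E hnd hY
      set L := Y ++ E with hL
      have hpart := isTourPart_petalsVec d d' hnd (U := Finset.univ \ L.toFinset) (by simp)
      rw [Finset.union_sdiff_of_subset (Finset.subset_univ _)] at hpart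
      have hfeas := hpart.isFeasible (C := C) fun a => by simpa using (hC_nonempty a).exists_mem
      have hYmem : ∀ v, v ∈ Y ↔ v ∈ S := fun v => by rw [← hY, List.mem_toFinset]
      have := hℓ _ hfeas (by
        simp only [gsecLHS]
        rw [edgeSum_petalsVec_delta d d' (fun v hv hvS => by
            simp [hL, (hYmem v).2 (by simpa using hvS)] at hv),
          edgeSum_petal_delta d (fun v hv => by simpa using (hYmem v).1 hv)
            (List.ne_nil_of_mem ((hYmem i).2 hi))
            (fun v hv hvS => List.disjoint_of_nodup_append hnd
              ((hYmem v).2 (by simpa using hvS)) hv)]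
        simp)
      rw [hsplit] at this
      exact eq_sub_of_add_eq this)
  -- At feasible points the degree of `v` is `2 * y v`, so the degree weights merge with the `y`
  -- part of `ℓ`.
  set e : T → ℝ := fun v => 2 * τ v + ψ (fun w => if v = w then 1 else 0) with he
  have hfeas_eq : ∀ z, IsFeasibleGMDTSP C z → ℓ z =
      ∑ v, e v * z.2 v + t * edgeSum z.1 (deltaEdges (targetSet D (S : Set T))) := by
    intro z hz
    rw [hsplit, hτ, LinearMap.pi_apply_eq_sum_univ ψ z.2]
    simp only [hz.degree, he, add_mul, Finset.sum_add_distrib, smul_eq_mul]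
    have h1 : ∀ v, τ v * (2 * z.2 v) = 2 * τ v * z.2 v := fun v => by ring
    have h2 : ∀ v, z.2 v * ψ (fun w => if v = w then 1 else 0) =
      ψ (fun w => if v = w then 1 else 0) * z.2 v := fun v => mul_comm _ _
    simp only [h1, h2]
    ring
  have hsum : ∀ W : Finset T, ∑ v, e v * (W : Set T).indicator 1 v = ∑ v ∈ W, e v := by
    intro W
    rw [← Finset.sum_filter_add_sum_filter_not _ (· ∈ W)]
    simp only [Finset.filter_mem_eq_inter, Finset.univ_inter]
    rw [add_eq_left.2]
    · exact Finset.sum_congr rfl fun v hv => by simp [hv]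
    · exact Finset.sum_eq_zero fun v hv => by simp [(Finset.mem_filter.1 hv).2]
  -- the tight solutions that visit the targets of `S'` consecutively, and the targets of `U`
  have htight : ∀ S' U : Finset T, S' ⊆ S → S'.Nonempty → (∀ v ∈ U, v ∉ S) →
      (∀ a, ∃ v ∈ C a, v ∈ S' ∪ U) → (i ∈ S' ∨ betaBar C S = 0) →
      ∑ v ∈ S' ∪ U, e v + t * 2 = c := by
    intro S' U hS' hne hU hCU hβ
    have hpart := isTourPart_petalsVec d₀ d₀ (Finset.nodup_toList S') (U := U)
      fun v hv hv' => hU v hv (hS' (Finset.mem_toList.1 hv'))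
    rw [Finset.toList_toFinset] at hpart
    have hfeas := hpart.isFeasible hCU
    have hcut : edgeSum (petalsVec d₀ d₀ S'.toList U) (deltaEdges (targetSet D (S : Set T))) =
        2 := by
      have := edgeSum_petal_delta (A := (S : Set T)) d₀ (L := S'.toList) (L' := [])
        (fun v hv => by simpa using hS' (Finset.mem_toList.1 hv)) (by simpa using hne.ne_empty)
        (by simp)
      rwa [List.append_nil, ← edgeSum_petalsVec_delta d₀ d₀ (by simpa using hU)] at this
    rw [← hℓ _ hfeas, hfeas_eq _ hfeas, hsum, hcut]
    simp only [gsecLHS, hcut]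
    rcases hβ with h | h
    · simp [h]
    · simp [h]
  have hne : S.Nonempty := ⟨i, hi⟩
  have hfull : ∑ v, e v + t * 2 = c := by
    have := htight S (Finset.univ \ S) subset_rfl hne (by simp)
      (fun a => by simpa using (hC_nonempty a).exists_mem) (Or.inl hi)
    rwa [Finset.union_sdiff_of_subset (Finset.subset_univ _)] at this
  -- Omitting `v` from a tight flower through all targets keeps it feasible unless `{v}` is a
  -- cluster. It stays tight because `S.erase v` is nonempty and either `y_i` is still `1` or its
  -- coefficient is `0`.
  have hdrop : ∀ v, (∀ a, v ∈ C a → ∃ w ∈ C a, w ≠ v) → (v ≠ i ∨ betaBar C S = 0) →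
      e v = 0 := by
    intro v hv hβ
    have hunion : S.erase v ∪ (Finset.univ \ S).erase v = Finset.univ.erase v := by
      rw [← Finset.erase_union_distrib, Finset.union_sdiff_of_subset (Finset.subset_univ _)]
    have := htight (S.erase v) ((Finset.univ \ S).erase v) (Finset.erase_subset _ _)
      (Finset.card_pos.1 (by have := Finset.pred_card_le_card_erase (s := S) (a := v); omega))
      (by simp) (fun a => by
        rw [hunion]
        by_cases hva : v ∈ C a
        · obtain ⟨w, hw, hwv⟩ := hv a hva
          exact ⟨w, hw, by simpa using hwv⟩
        · obtain ⟨w, hw⟩ := hC_nonempty a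
          exact ⟨w, hw, by simpa using fun h : w = v => hva (h ▸ hw)⟩)
      (hβ.imp_left fun h => Finset.mem_erase.2 ⟨h.symm, hi⟩)
    rw [hunion] at this
    have h1 := Finset.add_sum_erase Finset.univ e (Finset.mem_univ v)
    linarith
  have hsingle : ∀ z : GSpace T D, IsFeasibleGMDTSP C z → ∀ v a, v ∈ C a → (∀ w ∈ C a, w = v) →
      z.2 v = 1 := by
    intro z hz v a hva hall
    have h1 := hz.assignment a
    rw [Finset.eq_singleton_iff_unique_mem.2 ⟨hva, hall⟩, Finset.sum_singleton] at h1
    rcases hz.integer_y v with h | h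
    · linarith
    · exact h
  -- Either `e v = 0`, or a singleton cluster forces `y v = 1`; in both cases the term is constant
  -- on feasible points.
  have hzero : ∀ z : GSpace T D, IsFeasibleGMDTSP C z → ∀ v, (v ≠ i ∨ betaBar C S = 0) →
      e v * z.2 v = e v := by
    intro z hz v hβ
    by_cases hv : ∀ a, v ∈ C a → ∃ w ∈ C a, w ≠ v
    · rw [hdrop v hv hβ, zero_mul]
    · push Not at hv
      obtain ⟨a, hva, hall⟩ := hv
      rw [hsingle z hz v a hva hall, mul_one]
  by_cases hβ : ∃ a, C a ⊆ S
  · obtain ⟨a, ha⟩ := hβ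
    have hβ0 := betaBar_eq_zero_of_subset ha
    refine ⟨t, ∑ v, e v, fun z hz => ?_⟩
    rw [hfeas_eq z hz, gsecLHS, hβ0,
      Finset.sum_congr rfl fun v _ => hzero z hz v (Or.inr hβ0)]
    ring
  · push Not at hβ
    have hβ2 := betaBar_eq_two_of_forall_not_subset hβ
    -- With no cluster inside `S`, all of `S` may be skipped: the cut is `0`, and `2 * (1 - y_i) =
    -- 2` makes the constraint tight. The petal of `[]` is zero, since a loop at a depot is not an
    -- edge.
    have hout : ∑ v ∈ Finset.univ \ S, e v = c := by
      have hpart := isTourPart_petalsVec d₀ d₀ (L := []) List.nodup_nil (U := Finset.univ \ S)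
        (by simp)
      rw [List.toFinset_nil, Finset.empty_union] at hpart
      have hfeas := hpart.isFeasible (C := C) fun a => by
        obtain ⟨v, hv, hvS⟩ := Finset.not_subset.1 (hβ a)
        exact ⟨v, hv, by simpa using hvS⟩
      have hcut : edgeSum (petalsVec d₀ d₀ [] (Finset.univ \ S))
          (deltaEdges (targetSet D (S : Set T))) = 0 := by
        rw [edgeSum_petalsVec_delta d₀ d₀ (by simp), edgeSum_petal_delta_eq_zero d₀ (by simp)]
      rw [← hℓ _ hfeas, hfeas_eq _ hfeas, hsum, hcut, mul_zero, add_zero]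
      simp [gsecLHS, hcut, hβ2, hi]
    -- A cluster that contains `v ∈ S` also has a target outside `S`, so it is not a singleton and
    -- `hdrop` applies.
    have hin : ∑ v ∈ S, e v = e i := by
      refine Finset.sum_eq_single_of_mem i hi fun v hv hvi => hdrop v (fun a hva => ?_) (Or.inl hvi)
      obtain ⟨w, hw, hwS⟩ := Finset.not_subset.1 (hβ a)
      exact ⟨w, hw, fun h => hwS (h ▸ hv)⟩
    -- Visiting all of `S` and skipping all of it give the same value, so `e i + 2 * t = 0`: exactly
    -- the ratio of coefficients in the constraint.
    have hei : e i = -2 * t := by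
      have := Finset.sum_sdiff (f := e) (Finset.subset_univ S)
      linarith
    refine ⟨t, ∑ v, e v, fun z hz => ?_⟩
    have h1 := Finset.add_sum_erase Finset.univ (fun v => e v * z.2 v) (Finset.mem_univ i)
    have h2 := Finset.add_sum_erase Finset.univ e (Finset.mem_univ i)
    rw [Finset.sum_congr rfl fun v hv =>
      hzero z hz v (Or.inl (Finset.ne_of_mem_erase hv))] at h1
    rw [hfeas_eq z hz, gsecLHS, hβ2, ← h1, ← h2, hei]
    ring

end Gsec

theorem proposition4 {T D : Type*} [Fintype T] [Fintype D] [Nonempty D] {m : ℕ}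
    (C : Fin m → Finset T)
    (hC_nonempty : ∀ h, (C h).Nonempty)
    (hC_disjoint : ∀ h h', h ≠ h' → Disjoint (C h) (C h'))
    (hC_cover : ∀ v : T, ∃ h, v ∈ C h)
    (hT : 3 ≤ Fintype.card T)
    (S : Finset T) (i : T) (hi : i ∈ S) :
    IsValidFor (gmdtspPolytope D C) (gsecLHS C S i) 2 ∧
      (2 ≤ S.card → IsFacetDefiningFor (gmdtspPolytope D C) (gsecLHS C S i) 2) := by
  classical
  refine ⟨gsec_valid C hi, fun hS => ⟨gsec_valid C hi, ?_⟩⟩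
  obtain ⟨d⟩ := id ‹Nonempty D›
  have hall : ∀ a, ∃ v ∈ C a, v ∈ (Finset.univ : Finset T) := fun a => by
    simpa using (hC_nonempty a).exists_mem
  have hpart := isTourPart_petalsVec d d (Finset.nodup_toList S) (U := Finset.univ \ S) (by simp)
  rw [Finset.toList_toFinset, Finset.union_sdiff_of_subset (Finset.subset_univ _)] at hpart
  have hpart' := isTourPart_petalsVec d d (L := []) List.nodup_nil (U := (Finset.univ : Finset T))
    (by simp)
  rw [List.toFinset_nil, Finset.empty_union] at hpart'
  have hp : gsecLHS C S i (petalsVec d d S.toList (Finset.univ \ S),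
      ((Finset.univ : Finset T) : Set T).indicator 1) = 2 := by
    have := edgeSum_petal_delta (A := (S : Set T)) d (L := S.toList) (L' := [])
      (by simp) (by simpa using Finset.ne_empty_of_mem hi) (by simp)
    rw [List.append_nil, ← edgeSum_petalsVec_delta d d (U := Finset.univ \ S) (by simp)] at this
    simp [gsecLHS, this]
  -- With a separate petal for each target the cut is at least `2 * |S| ≥ 4`, so this feasible point
  -- is not tight.
  have hp' : gsecLHS C S i (petalsVec d d [] Finset.univ,
      ((Finset.univ : Finset T) : Set T).indicator 1) ≠ 2 := by
    have hle : ∑ u ∈ S, (2 : ℝ) ≤ edgeSum (∑ u, petal d [u])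
        (deltaEdges (targetSet D (S : Set T))) := by
      rw [edgeSum_sum]
      refine (Finset.sum_le_sum fun u hu => ?_).trans (Finset.sum_le_sum_of_subset_of_nonneg
        (Finset.subset_univ S) fun u _ _ => edgeSum_nonneg (walkVec_nonneg _) _)
      exact two_le_edgeSum_petal d (List.mem_singleton_self u) hu
    have hcard : (2 : ℝ) ≤ S.card := by exact_mod_cast hS
    rw [Finset.sum_const, nsmul_eq_mul] at hle
    simp only [gsecLHS, petalsVec, edgeSum_add]
    rw [edgeSum_petal_delta_eq_zero d (by simp)]
    simp only [Finset.coe_univ, Set.indicator_univ, Pi.one_apply, sub_self, mul_zero]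
    intro h
    linarith
  exact isFacet_convexHull (gsecLinear D S (betaBar C S) i).toContinuousLinearMap (betaBar C S)
    (gsecLHS_eq C S i) (gsec_valid C hi) (hpart.isFeasible hall) hp (hpart'.isFeasible hall) hp'
    fun ℓ hℓ => exists_eq_mul_gsecLHS_add C hC_nonempty hT S i hi hS ℓ _ hℓ
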